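/- **Setting.** A schema $\sigma$ is a finite set of relation names $R$, each with an arity $\operatorname{ar}(R)\ge 1$. A $\sigma$-database $\mathcal D$ consists of a finite domain $D$ and, for each $R\in\sigma$, a relation $R^{\mathcal D}\subseteq D^{\operatorname{ar}(R)}$. The degree of an element is the total number of tuples, in all relations of $\mathcal D$, that contain it; $\mathcal D$ has degree at most $d$ if all its elements do. The Gaifman graph of $\mathcal D$ has vertex set $D$, with two distinct elements adjacent if some tuple of $\mathcal D$ contains both; distances and connected components of $\mathcal D$ are those of its Gaifman graph. Fix $\sigma$ and an integer $d\ge 2$. Let $\mathbf C$ be an isomorphism-closed class of $\sigma$-databases of degree at most $d$, and let $\mathbf P\subseteq\mathbf C$ be a property, i.e. an isomorphism-closed class. * $\mathbf C$ is *closed under removing tuples* if removing any set of tuples from the relations of a member of $\mathbf C$ (keeping the domain) again gives a member of $\mathbf C$. * $\mathbf P$ is *hyperfinite on $\mathbf C$* if there is a function $\rho:(0,1]\to\mathbb N$ such that for every $\epsilon\in(0,1]$ and every $\mathcal D\in\mathbf P$, one can remove at most $\epsilon|D|$ tuples from $\mathcal D$ to obtain a database in $\mathbf C$ all of whose connected components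 have at most $\rho(\epsilon)$ elements. * For $r\in\mathbb N$ and $a\in D$, the *$r$-neighbourhood* of $a$ is the sub-database of $\mathcal D$ induced by the elements at distance at most $r$ from $a$, together with the centre $a$; the *$r$-type* of $a$ is its isomorphism class (isomorphisms map centres to centres). The *$r$-histogram* $\operatorname{h}_r(\mathcal D)$ is the vector, indexed by the $r$-types, whose component at $\tau$ is the number of elements of $\mathcal D$ of $r$-type $\tau$. * A *modification* of a database is the insertion of a new element (contained in no tuple) into the domain, the deletion of an element together with all tuples containing it, the insertion of a tuple, or the deletion of a tuple. $\operatorname{dist}_{+/ -}(\mathcal D,\mathcal D')$ is the minimum total number of modifications of $\mathcal D$ and $\mathcal D'$ that make them isomorphic. A database $\mathcal D'$ is *$\epsilon$-close to $\mathbf P$ in the $\operatorname{BDRD}_{+/ -}$ model* if there is $\mathcal D''\in\mathbf P$ with $\operatorname{dist}_{+/ -}(\mathcal D',\mathcal D'')\le\epsilon\, d\,\min\{|D'|,|D''|\}$. **Lemma (locality).** Let $\epsilon\in(0,1]$, let $\mathbf C$ be closed under removing tuples, and let $\mathbf P\subseteq\mathbf C$ be hyperfinite on $\mathbf C$. Then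 there exist $\lambda=\lambda(\epsilon)\in(0,1]$ and $r=r(\epsilon)\in\mathbb N$ such that for all $\mathcal D\in\mathbf P$ and $\mathcal D'\in\mathbf C$ (whose domains may have different sizes), if $$\|\operatorname{h}_r(\mathcal D)-\operatorname{h}_r(\mathcal D')\|_1\le\lambda\,\min\{|D|,|D'|\},$$ then $\mathcal D'$ is $\epsilon$-close to $\mathbf P$ in the $\operatorname{BDRD}_{+/ -}$ model. -/

import Mathlib

/-- A schema: a finite set of relation names, each with an arity at least one. -/
structure Schema where
  Rel : Type
  finite_rel : Finite Rel
  arity : Rel → ℕ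
  arity_pos : ∀ R, 1 ≤ arity R

/-- A (finite) database of schema `σ`: a finite domain, and for every relation name `R` an
`arity R`-ary relation on the domain. -/
structure Database (σ : Schema) where
  Dom : Type
  finite_dom : Finite Dom
  rel : ∀ R : σ.Rel, Set (Fin (σ.arity R) → Dom)

attribute [instance] Schema.finite_rel Database.finite_dom

namespace Database

variable {σ : Schema}

/-- The number of elements of the domain, `|D|`. -/
noncomputable def size (D : Database σ) : ℕ := Nat.card D.Dom

/-- A possible tuple over the domain of `D`, labelled with the name of the relation it is
meant for. -/
abbrev Fact (D : Database σ) : Type := Σ R : σ.Rel, (Fin (σ.arity R) → D.Dom)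

/-- The tuples in all relations of `D`, each labelled with the name of its relation. -/
def facts (D : Database σ) : Set D.Fact := {f | f.2 ∈ D.rel f.1}

/-- The database with the same domain as `D` whose tuples are those in `F`. -/
def withFacts (D : Database σ) (F : Set D.Fact) : Database σ where
  Dom := D.Dom
  finite_dom := D.finite_dom
  rel R := {t | (⟨R, t⟩ : D.Fact) ∈ F}

/-- `D` with the tuples in `S` removed (the domain stays the same). -/
def removeTuples (D : Database σ) (S : Set D.Fact) : Database σ := D.withFacts (D.facts \ S)

/-- `D` with the tuple `f` inserted. -/
def insertTuple (D : Database σ) (f : D.Fact) : Database σ := D.withFacts (insert f D.facts)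

/-- `D` with one new element, contained in no tuple, inserted into the domain. -/
def insertElement (D : Database σ) : Database σ where
  Dom := Option D.Dom
  finite_dom := inferInstance
  rel R := {t | ∃ s ∈ D.rel R, t = fun i => some (s i)}

/-- The sub-database of `D` induced by a set `M` of elements. -/
def induce (D : Database σ) (M : Set D.Dom) : Database σ where
  Dom := M
  finite_dom := inferInstance
  rel R := {t | (fun i => (t i : D.Dom)) ∈ D.rel R}

/-- `D` with the element `a`, and hence every tuple containing `a`, deleted. -/
def deleteElement (D : Database σ) (a : D.Dom) : Database σ := D.induce {a}ᶜ

/-- A bijection between the domains is an isomorphism if it preserves and reflects all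
relations. -/
def IsIsomorphism (D E : Database σ) (e : D.Dom ≃ E.Dom) : Prop :=
  ∀ (R : σ.Rel) (t : Fin (σ.arity R) → D.Dom), t ∈ D.rel R ↔ (fun i => e (t i)) ∈ E.rel R

/-- Two databases are isomorphic. -/
def Isomorphic (D E : Database σ) : Prop := ∃ e : D.Dom ≃ E.Dom, IsIsomorphism D E e

/-- The degree of an element: the number of tuples in all relations that contain it. -/
noncomputable def elemDegree (D : Database σ) (a : D.Dom) : ℕ :=
  {f ∈ D.facts | a ∈ Set.range f.2}.ncard

/-- The database has degree at most `d`. -/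
def DegreeLE (D : Database σ) (d : ℕ) : Prop := ∀ a : D.Dom, D.elemDegree a ≤ d

/-- The Gaifman graph: distinct elements are adjacent when some tuple contains both. -/
def gaifman (D : Database σ) : SimpleGraph D.Dom where
  Adj a b := a ≠ b ∧ ∃ f ∈ D.facts, a ∈ Set.range f.2 ∧ b ∈ Set.range f.2
  symm := ⟨fun _ _ h => ⟨h.1.symm, let ⟨f, hf, ha, hb⟩ := h.2; ⟨f, hf, hb, ha⟩⟩⟩
  loopless := ⟨fun _ h => h.1 rfl⟩

/-! ### Neighbourhoods and histograms -/

/-- The set `N_r(a)` of elements at distance at most `r` from `a` in the Gaifman graph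
(elements of other components are at distance `⊤`). -/
def ball (D : Database σ) (r : ℕ) (a : D.Dom) : Set D.Dom :=
  {b | D.gaifman.edist a b ≤ (r : ℕ∞)}

theorem mem_ball_self (D : Database σ) (r : ℕ) (a : D.Dom) : a ∈ D.ball r a := by
  simp [ball]

end Database

/-- A database with a distinguished element, its centre. -/
structure PointedDatabase (σ : Schema) where
  db : Database σ
  centre : db.Dom

namespace PointedDatabase

/-- Isomorphism of databases with a centre: the centre has to be mapped to the centre. -/
def Isomorphic {σ : Schema} (A B : PointedDatabase σ) : Prop :=
  ∃ e : A.db.Dom ≃ B.db.Dom, Database.IsIsomorphism A.db B.db e ∧ e A.centre = B.centre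

instance setoid (σ : Schema) : Setoid (PointedDatabase σ) where
  r := Isomorphic
  iseqv :=
    { refl := fun _ => ⟨Equiv.refl _, fun _ _ => Iff.rfl, rfl⟩
      symm := by
        rintro A B ⟨e, he, hc⟩
        refine ⟨e.symm, fun R t => ?_, by rw [← hc, e.symm_apply_apply]⟩
        rw [he R]
        simp
      trans := by
        rintro A B C ⟨e, he, hc⟩ ⟨g, hg, hd⟩
        refine ⟨e.trans g, fun R t => ?_, by simp [hc, hd]⟩
        rw [he R, hg R]
        rfl }

end PointedDatabase

/-- Isomorphism classes of databases with a centre. The `r`-types are those classes that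
consist of `r`-neighbourhoods. -/
def NeighbourhoodType (σ : Schema) : Type 1 := Quotient (PointedDatabase.setoid σ)

namespace Database

variable {σ : Schema}

/-- The `r`-neighbourhood of `a`: the sub-database induced by `N_r(a)`, with centre `a`. -/
def neighbourhood (D : Database σ) (r : ℕ) (a : D.Dom) : PointedDatabase σ where
  db := D.induce (D.ball r a)
  centre := ⟨a, D.mem_ball_self r a⟩

/-- The `r`-type of the element `a`. -/
def typeOf (D : Database σ) (r : ℕ) (a : D.Dom) : NeighbourhoodType σ :=
  Quotient.mk (PointedDatabase.setoid σ) (D.neighbourhood r a)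

/-- The `r`-histogram: the component at `τ` is the number of elements whose `r`-type is `τ`.
(Components at classes which are not the `r`-type of any element are zero.) -/
noncomputable def histogram (D : Database σ) (r : ℕ) (τ : NeighbourhoodType σ) : ℕ :=
  {a : D.Dom | D.typeOf r a = τ}.ncard

/-- The `ℓ¹`-distance `‖h_r(D) - h_r(E)‖₁`; only finitely many terms are nonzero, see
`finite_support_histogram_sub`. -/
noncomputable def histogramDist (r : ℕ) (D E : Database σ) : ℝ :=
  ∑ᶠ τ : NeighbourhoodType σ, |(D.histogram r τ : ℝ) - (E.histogram r τ : ℝ)|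

theorem finite_support_histogram_sub (r : ℕ) (D E : Database σ) :
    (Function.support fun τ : NeighbourhoodType σ =>
      |(D.histogram r τ : ℝ) - (E.histogram r τ : ℝ)|).Finite := by
  refine ((Set.finite_range (D.typeOf r)).union (Set.finite_range (E.typeOf r))).subset ?_
  intro τ hτ
  by_contra h
  simp only [Set.mem_union, Set.mem_range, not_or, not_exists] at h
  apply hτ
  have h1 : D.histogram r τ = 0 := by
    simp [histogram, h.1]
  have h2 : E.histogram r τ = 0 := by
    simp [histogram, h.2]
  simp [h1, h2]

/-! ### Modifications and distance -/

/-- A single modification of a database. -/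
inductive Modification : Database σ → Database σ → Prop
  | insertElement (D : Database σ) : Modification D D.insertElement
  | deleteElement (D : Database σ) (a : D.Dom) : Modification D (D.deleteElement a)
  | insertTuple (D : Database σ) (f : D.Fact) (hf : f ∉ D.facts) :
      Modification D (D.insertTuple f)
  | deleteTuple (D : Database σ) (f : D.Fact) (hf : f ∈ D.facts) :
      Modification D (D.removeTuples {f})

/-- `ModifiesIn k D E`: a sequence of exactly `k` modifications leads from `D` to `E`. -/
inductive ModifiesIn : ℕ → Database σ → Database σ → Prop
  | refl (D : Database σ) : ModifiesIn 0 D D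
  | step {k : ℕ} {D E F : Database σ} (h : Modification D E) (hs : ModifiesIn k E F) :
      ModifiesIn (k + 1) D F

/-- `D` and `E` can be made isomorphic by a total of `m` modifications of `D` and of `E`. -/
def MadeIsomorphicIn (m : ℕ) (D E : Database σ) : Prop :=
  ∃ (k l : ℕ) (D₁ E₁ : Database σ),
    k + l = m ∧ ModifiesIn k D D₁ ∧ ModifiesIn l E E₁ ∧ Isomorphic D₁ E₁

/-- The distance `dist₊₋(D, E)`: the minimum number of modifications of `D` and `E` that make
them isomorphic (the minimum is over a nonempty set, see `exists_madeIsomorphicIn`). -/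
noncomputable def modDist (D E : Database σ) : ℕ := sInf {m | MadeIsomorphicIn m D E}

theorem exists_modifiesIn_empty (n : ℕ) (D : Database σ) (h : Nat.card D.Dom = n) :
    ∃ E : Database σ, ModifiesIn n D E ∧ IsEmpty E.Dom := by
  induction n generalizing D with
  | zero => exact ⟨D, .refl D, (Nat.card_eq_zero.1 h).resolve_right (fun hi => hi.not_finite inferInstance)⟩
  | succ n ih =>
    obtain ⟨a⟩ : Nonempty D.Dom := (Nat.card_pos_iff.1 (by omega)).1
    have hc : Nat.card (D.deleteElement a).Dom = n := by
      have h2 := Set.ncard_add_ncard_compl ({a} : Set D.Dom)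
      rw [Set.ncard_singleton] at h2
      change ({a}ᶜ : Set D.Dom).ncard = n
      omega
    obtain ⟨E, hE, hE'⟩ := ih _ hc
    exact ⟨E, .step (.deleteElement D a) hE, hE'⟩

theorem exists_madeIsomorphicIn (D E : Database σ) :
    {m | MadeIsomorphicIn m D E}.Nonempty := by
  obtain ⟨D₁, hD, hD'⟩ := exists_modifiesIn_empty _ D rfl
  obtain ⟨E₁, hE, hE'⟩ := exists_modifiesIn_empty _ E rfl
  refine ⟨_, _, _, D₁, E₁, rfl, hD, hE, Equiv.equivOfIsEmpty _ _, fun R t => ?_⟩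
  exact (hD'.false (t ⟨0, σ.arity_pos R⟩)).elim

/-- `D` and `E` are `ε`-close in the model with insertion and deletion of elements, for
databases of degree at most `d`. -/
def IsClose (d : ℕ) (ε : ℝ) (D E : Database σ) : Prop :=
  (modDist D E : ℝ) ≤ ε * d * (min D.size E.size : ℕ)

/-- `D` is `ε`-close to the property `P`. -/
def IsCloseTo (d : ℕ) (ε : ℝ) (D : Database σ) (P : Set (Database σ)) : Prop :=
  ∃ E ∈ P, IsClose d ε D E

/-! ### Classes of databases -/

/-- The class is closed under isomorphism. -/
def IsoClosed (C : Set (Database σ)) : Prop :=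
  ∀ D E : Database σ, Isomorphic D E → D ∈ C → E ∈ C

/-- The class is closed under removing tuples. -/
def ClosedUnderTupleRemoval (C : Set (Database σ)) : Prop :=
  ∀ D ∈ C, ∀ S : Set D.Fact, D.removeTuples S ∈ C

/-- `E` is an `(ε, k)`-partition of `D`: it arises by removing at most `ε |D|` tuples, and each
of its connected components contains at most `k` elements. -/
def IsPartition (ε : ℝ) (k : ℕ) (D E : Database σ) : Prop :=
  ∃ S : Set D.Fact, S ⊆ D.facts ∧ (S.ncard : ℝ) ≤ ε * D.size ∧ E = D.removeTuples S ∧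
    ∀ c : E.gaifman.ConnectedComponent, c.supp.ncard ≤ k

/-- `P` is hyperfinite on `C`. -/
def HyperfiniteOn (P C : Set (Database σ)) : Prop :=
  ∃ ρ : ℝ → ℕ, ∀ ε : ℝ, 0 < ε → ε ≤ 1 → ∀ D ∈ P, ∃ E ∈ C, IsPartition ε (ρ ε) D E

end Database

/-- A system of local symmetries of a finite set `V`: for every radius `t` and every point `v`, the
permutations that act as a symmetry on the ball of radius `t` around `v`. -/
structure LocalSymmetry (V : Type*) where
  sym : ℕ → V → Finset (Equiv.Perm V)
  ball : ℕ → V → Finset V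
  one_mem : ∀ t v, 1 ∈ sym t v
  inv_mem : ∀ {t v e}, e ∈ sym t v → e⁻¹ ∈ sym t (e v)
  mul_mem : ∀ {t v e f}, e ∈ sym t v → f ∈ sym t (e v) → f * e ∈ sym t v
  mem_ball_self : ∀ t v, v ∈ ball t v
  ball_symm : ∀ {t v w}, w ∈ ball t v → v ∈ ball t w
  restrict : ∀ {t k v w e}, e ∈ sym (t + k) v → w ∈ ball k v → e ∈ sym t w
  map_ball : ∀ {t k v w e}, e ∈ sym t v → k ≤ t → w ∈ ball k v → e w ∈ ball k (e v)

namespace LocalSymmetry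

variable {V : Type*} (G : LocalSymmetry V)

/-- The average of `h (e v)` over the symmetries `e` of radius `r` at `u`. -/
noncomputable def transfer (r : ℕ) (h : V → ℝ) (u v : V) : ℝ :=
  (∑ e ∈ G.sym r u, h (e v)) / (G.sym r u).card

/-- The average of `h` over the images of `x` under the symmetries of radius `t` at `x`. -/
noncomputable def avg (t : ℕ) (h : V → ℝ) (x : V) : ℝ := G.transfer t h x x

/-- `c` is constant along the symmetries of radius `t`. -/
def Invariant (t : ℕ) (c : V → ℝ) : Prop := ∀ x, ∀ e ∈ G.sym t x, c (e x) = c x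

variable {G}

theorem sym_anti {s t : ℕ} (hst : s ≤ t) (x : V) : G.sym t x ⊆ G.sym s x := by
  intro e he
  obtain ⟨k, rfl⟩ := Nat.exists_eq_add_of_le hst
  exact G.restrict he (G.mem_ball_self k x)

theorem Invariant.mono {s t : ℕ} (hst : s ≤ t) {c : V → ℝ} (hc : G.Invariant s c) :
    G.Invariant t c := fun x e he => hc x e (sym_anti hst x he)

theorem card_sym_pos (t : ℕ) (x : V) : (0 : ℝ) < (G.sym t x).card := by
  exact_mod_cast Finset.card_pos.2 ⟨1, G.one_mem t x⟩

theorem inv_mem_iff {t : ℕ} {x : V} {e : Equiv.Perm V} (he : e ∈ G.sym t x) (f : Equiv.Perm V) :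
    f ∈ G.sym t (e x) ↔ f * e ∈ G.sym t x := by
  refine ⟨fun hf => G.mul_mem he hf, fun hf => ?_⟩
  have h1 := G.inv_mem he
  have h2 : f * e ∈ G.sym t (e⁻¹ (e x)) := by simpa using hf
  simpa using G.mul_mem h1 h2

theorem sum_sym_map {t : ℕ} {x : V} {e : Equiv.Perm V} (he : e ∈ G.sym t x)
    (F : Equiv.Perm V → ℝ) : ∑ f ∈ G.sym t (e x), F f = ∑ f ∈ G.sym t x, F (f * e⁻¹) := by
  refine Finset.sum_nbij' (fun f => f * e) (fun f => f * e⁻¹) ?_ ?_ ?_ ?_ ?_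
  · exact fun f hf => (inv_mem_iff he f).1 hf
  · exact fun f hf => (inv_mem_iff he _).2 (by simpa using hf)
  · simp
  · simp
  · simp

theorem card_sym_map {t : ℕ} {x : V} {e : Equiv.Perm V} (he : e ∈ G.sym t x) :
    ((G.sym t (e x)).card : ℝ) = (G.sym t x).card := by
  have := sum_sym_map he (fun _ => 1)
  simpa using this

theorem transfer_mono {r : ℕ} {h h' : V → ℝ} (hh : ∀ v, h v ≤ h' v) (u v : V) :
    G.transfer r h u v ≤ G.transfer r h' u v := by
  unfold transfer
  gcongr
  exact hh _

theorem transfer_const (r : ℕ) (c : ℝ) (u v : V) : G.transfer r (fun _ => c) u v = c := by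
  have := (card_sym_pos (G := G) r u).ne'
  simp [transfer]
  field_simp

theorem transfer_sub (r : ℕ) (h h' : V → ℝ) (u v : V) :
    G.transfer r (fun x => h x - h' x) u v = G.transfer r h u v - G.transfer r h' u v := by
  simp [transfer, Finset.sum_sub_distrib, sub_div]

theorem abs_transfer_le (r : ℕ) (h : V → ℝ) (u v : V) :
    |G.transfer r h u v| ≤ G.transfer r (fun x => |h x|) u v := by
  unfold transfer
  rw [abs_div, Nat.abs_cast]
  gcongr
  exact Finset.abs_sum_le_sum_abs _ _

theorem transfer_sq_le (r : ℕ) (h : V → ℝ) (u v : V) :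
    G.transfer r h u v ^ 2 ≤ G.transfer r (fun x => h x ^ 2) u v := by
  have h0 := card_sym_pos (G := G) r u
  unfold transfer
  rw [div_pow, div_le_div_iff₀ (by positivity) h0]
  have := sq_sum_le_card_mul_sum_sq (s := G.sym r u) (f := fun e => h (e v))
  calc _ ≤ ((G.sym r u).card * ∑ e ∈ G.sym r u, h (e v) ^ 2) * ((G.sym r u).card : ℝ) := by
        gcongr
    _ = _ := by ring

theorem avg_nonneg {t : ℕ} {h : V → ℝ} (hh : ∀ v, 0 ≤ h v) (x : V) : 0 ≤ G.avg t h x := by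
  have := transfer_mono (G := G) (r := t) hh x x
  rwa [transfer_const] at this

theorem avg_le_one {t : ℕ} {h : V → ℝ} (hh : ∀ v, h v ≤ 1) (x : V) : G.avg t h x ≤ 1 := by
  have := transfer_mono (G := G) (r := t) hh x x
  rwa [transfer_const] at this

theorem invariant_avg (t : ℕ) (h : V → ℝ) : G.Invariant t (G.avg t h) := by
  intro x e he
  unfold avg transfer
  rw [card_sym_map he, sum_sym_map he]
  simp

theorem sum_closed_avg {t : ℕ} (h : V → ℝ) (F : Finset (Equiv.Perm V)) (v : V)
    (hF : ∀ e ∈ F, ∀ f ∈ G.sym t (e v), f * e ∈ F) :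
    ∑ e ∈ F, G.avg t h (e v) = ∑ e ∈ F, h (e v) := by
  unfold avg transfer
  simp only [Finset.sum_div]
  rw [Finset.sum_sigma']
  have key : ∑ p ∈ F.sigma (fun e => G.sym t (e v)),
        h (p.2 (p.1 v)) / ((G.sym t (p.1 v)).card : ℝ)
      = ∑ p ∈ F.sigma (fun e => G.sym t (e v)), h (p.1 v) / ((G.sym t (p.1 v)).card : ℝ) := by
    refine Finset.sum_nbij' (fun p => ⟨p.2 * p.1, p.2⁻¹⟩) (fun p => ⟨p.2 * p.1, p.2⁻¹⟩)
      ?_ ?_ ?_ ?_ ?_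
    · rintro ⟨e, f⟩ hp
      simp only [Finset.mem_sigma] at hp ⊢
      exact ⟨hF e hp.1 f hp.2, G.inv_mem hp.2⟩
    · rintro ⟨e, f⟩ hp
      simp only [Finset.mem_sigma] at hp ⊢
      exact ⟨hF e hp.1 f hp.2, G.inv_mem hp.2⟩
    · simp
    · simp
    · rintro ⟨e, f⟩ hp
      simp only [Finset.mem_sigma] at hp
      simp [card_sym_map hp.2]
  rw [key, Finset.sum_sigma]
  refine Finset.sum_congr rfl fun e _ => ?_
  have := (card_sym_pos (G := G) t (e v)).ne'
  simp
  field_simp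

theorem transfer_avg {r k : ℕ} (hk : k ≤ r) (h : V → ℝ) {u v : V} (hv : v ∈ G.ball k u) :
    G.transfer r (G.avg (r + k) h) u v = G.transfer r h u v := by
  unfold transfer
  rw [sum_closed_avg]
  intro e he f hf
  have : e u ∈ G.ball k (e v) := G.ball_symm (G.map_ball he hk hv)
  exact G.mul_mem he (G.restrict hf this)

theorem avg_avg {s t : ℕ} (hst : s ≤ t) (h : V → ℝ) (x : V) :
    G.avg s (G.avg t h) x = G.avg s h x := by
  change G.transfer s _ x x = G.transfer s h x x
  unfold transfer
  rw [sum_closed_avg]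
  exact fun e he f hf => G.mul_mem he (sym_anti hst _ hf)

theorem transfer_of_invariant {s k : ℕ} {c : V → ℝ} (hc : G.Invariant s c) {u v : V}
    (hv : v ∈ G.ball k u) : G.transfer (s + k) c u v = c v := by
  have h0 := (card_sym_pos (G := G) (s + k) u).ne'
  unfold transfer
  rw [Finset.sum_congr rfl fun e he => hc v e (G.restrict he hv)]
  simp
  field_simp

/-- The indicator function of a finite set. -/
def ind [DecidableEq V] (T : Finset V) (v : V) : ℝ := if v ∈ T then 1 else 0

theorem ind_nonneg [DecidableEq V] (T : Finset V) (v : V) : 0 ≤ ind T v := by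
  unfold ind
  split <;> norm_num

theorem ind_le_one [DecidableEq V] (T : Finset V) (v : V) : ind T v ≤ 1 := by
  unfold ind
  split <;> norm_num

/-- `K` assigns to the elements of `A` the parts of a partition of `A`, of radius at most `k`. -/
structure IsPartition (G : LocalSymmetry V) (k : ℕ) (A : Finset V) (K : V → Finset V) : Prop where
  mem_self : ∀ u ∈ A, u ∈ K u
  subset : ∀ u ∈ A, K u ⊆ A
  subset_ball : ∀ u ∈ A, K u ⊆ G.ball k u
  eq_of_mem : ∀ u ∈ A, ∀ v ∈ K u, K v = K u

theorem IsPartition.sum_div_card {k : ℕ} {A : Finset V} {K : V → Finset V}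
    (hK : G.IsPartition k A K) (F : V → ℝ) :
    ∑ u ∈ A, (∑ v ∈ K u, F v) / (K u).card = ∑ v ∈ A, F v := by
  simp only [Finset.sum_div]
  rw [Finset.sum_comm' (t' := A) (s' := fun v => K v)]
  · refine Finset.sum_congr rfl fun v hv => ?_
    have h1 : ∀ u ∈ K v, F v / (K u).card = F v / (K v).card := fun u hu => by
      rw [hK.eq_of_mem v hv u hu]
    have h2 : ((K v).card : ℝ) ≠ 0 := by
      have := Finset.card_pos.2 ⟨v, hK.mem_self v hv⟩
      positivity
    rw [Finset.sum_congr rfl h1]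
    simp
    field_simp
  · intro u v
    constructor
    · rintro ⟨hu, hv⟩
      refine ⟨?_, hK.subset u hu hv⟩
      rw [hK.eq_of_mem u hu v hv]
      exact hK.mem_self u hu
    · rintro ⟨hu, hv⟩
      refine ⟨hK.subset v hv hu, ?_⟩
      rw [hK.eq_of_mem v hv u hu]
      exact hK.mem_self v hv

theorem transfer_sum_comm {r : ℕ} (u : V) (K : Finset V) (g h : V → ℝ) :
    ∑ v ∈ K, g v * G.transfer r h u v
      = (∑ e ∈ G.sym r u, ∑ v ∈ K, g v * h (e v)) / (G.sym r u).card := by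
  unfold transfer
  rw [Finset.sum_comm, Finset.sum_div]
  simp only [Finset.sum_div, Finset.mul_sum, mul_div_assoc]

variable [Fintype V]

theorem sum_avg_mul (t : ℕ) (h g : V → ℝ) :
    ∑ x, G.avg t h x * g x = ∑ x, h x * G.avg t g x := by
  unfold avg transfer
  simp only [Finset.sum_div, Finset.sum_mul, Finset.mul_sum]
  rw [Finset.sum_sigma', Finset.sum_sigma']
  refine Finset.sum_nbij' (fun p => ⟨p.2 p.1, p.2⁻¹⟩) (fun p => ⟨p.2 p.1, p.2⁻¹⟩) ?_ ?_ ?_ ?_ ?_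
  · rintro ⟨x, e⟩ hp
    simp only [Finset.mem_sigma, Finset.mem_univ, true_and] at hp ⊢
    exact G.inv_mem hp
  · rintro ⟨x, e⟩ hp
    simp only [Finset.mem_sigma, Finset.mem_univ, true_and] at hp ⊢
    exact G.inv_mem hp
  · simp
  · simp
  · rintro ⟨x, e⟩ hp
    simp only [Finset.mem_sigma, Finset.mem_univ, true_and] at hp
    simp [card_sym_map hp]
    ring

theorem sum_avg (t : ℕ) (h : V → ℝ) : ∑ x, G.avg t h x = ∑ x, h x := by
  have := sum_avg_mul (G := G) t h (fun _ => 1)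
  simpa [avg, transfer_const] using this

/-- The energy of `h` at scale `t`. -/
noncomputable def energy (G : LocalSymmetry V) (t : ℕ) (h : V → ℝ) : ℝ := ∑ x, G.avg t h x ^ 2

theorem sum_sq_avg_sub {s t : ℕ} (hst : s ≤ t) (h : V → ℝ) :
    ∑ x, (G.avg t h x - G.avg s h x) ^ 2 = G.energy t h - G.energy s h := by
  have h1 : ∑ x, G.avg t h x * G.avg s h x = ∑ x, h x * G.avg s h x := by
    rw [Finset.sum_congr rfl fun x _ => mul_comm (G.avg t h x) (G.avg s h x), sum_avg_mul]
    simp only [avg_avg hst]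
  have h2 : ∑ x, G.avg s h x * G.avg s h x = ∑ x, h x * G.avg s h x := by
    rw [sum_avg_mul]
    simp only [avg_avg le_rfl]
  have h3 : ∑ x, (G.avg t h x - G.avg s h x) ^ 2 = ∑ x, G.avg t h x ^ 2
      - 2 * ∑ x, G.avg t h x * G.avg s h x + ∑ x, G.avg s h x * G.avg s h x := by
    rw [Finset.mul_sum, ← Finset.sum_sub_distrib, ← Finset.sum_add_distrib]
    exact Finset.sum_congr rfl fun x _ => by ring
  have h4 : G.energy s h = ∑ x, G.avg s h x * G.avg s h x :=
    Finset.sum_congr rfl fun x _ => by ring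
  rw [h3, h4, h1, h2, energy]
  ring

theorem energy_nonneg (t : ℕ) (h : V → ℝ) : 0 ≤ G.energy t h :=
  Finset.sum_nonneg fun _ _ => sq_nonneg _

theorem energy_le_card {t : ℕ} {h : V → ℝ} (h0 : ∀ v, 0 ≤ h v) (h1 : ∀ v, h v ≤ 1) :
    G.energy t h ≤ Fintype.card V := by
  have : G.energy t h ≤ ∑ _x : V, (1 : ℝ) :=
    Finset.sum_le_sum fun x _ => pow_le_one₀ (avg_nonneg h0 x) (avg_le_one h1 x)
  simpa using this

theorem sum_ball_transfer {r k : ℕ} (hk : k ≤ r) (h : V → ℝ) :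
    ∑ u, ∑ v ∈ G.ball k u, G.transfer r h u v = ∑ u, ∑ v ∈ G.ball k u, h v := by
  rw [← sum_avg (G := G) r (fun u => ∑ v ∈ G.ball k u, h v)]
  refine Finset.sum_congr rfl fun u _ => ?_
  unfold avg transfer
  rw [← Finset.sum_div, Finset.sum_comm]
  congr 1
  refine Finset.sum_congr rfl fun e he => ?_
  refine Finset.sum_nbij' (fun v => e v) (fun v => e⁻¹ v) ?_ ?_ ?_ ?_ ?_
  · exact fun v hv => G.map_ball he hk hv
  · intro v hv
    have := G.map_ball (G.inv_mem he) hk hv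
    simpa using this
  · simp
  · simp
  · simp

theorem sum_ball_le {k b : ℕ} (hb : ∀ v, (G.ball k v).card ≤ b) {h : V → ℝ} (hh : ∀ v, 0 ≤ h v) :
    ∑ u, ∑ v ∈ G.ball k u, h v ≤ b * ∑ v, h v := by
  rw [Finset.sum_comm' (t' := Finset.univ) (s' := fun v => G.ball k v), Finset.mul_sum]
  · refine Finset.sum_le_sum fun v _ => ?_
    simp only [Finset.sum_const, nsmul_eq_mul]
    have : ((G.ball k v).card : ℝ) ≤ b := by exact_mod_cast hb v
    exact mul_le_mul_of_nonneg_right this (hh v)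
  · intro u v
    simp only [Finset.mem_univ, true_and, and_true]
    exact ⟨G.ball_symm, G.ball_symm⟩

/-- The total deviation of the averages of `h` along symmetries of the balls of radius `s + k` from
the averages of `h` at scale `s`. -/
noncomputable def deviation (G : LocalSymmetry V) (s k : ℕ) (h : V → ℝ) : ℝ :=
  ∑ u, ∑ v ∈ G.ball k u, |G.transfer (s + k) h u v - G.avg s h v|

theorem deviation_sq_le {s k b : ℕ} (hb : ∀ v, (G.ball k v).card ≤ b) (h : V → ℝ) :
    G.deviation s k h ^ 2 ≤
      (b : ℝ) ^ 2 * Fintype.card V * (G.energy (s + k + k) h - G.energy s h) := by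
  set q : V → ℝ := fun x => G.avg (s + k + k) h x - G.avg s h x with hq
  have h1 : ∀ u, ∀ v ∈ G.ball k u,
      |G.transfer (s + k) h u v - G.avg s h v| ^ 2 ≤ G.transfer (s + k) (fun x => q x ^ 2) u v := by
    intro u v hv
    have : G.transfer (s + k) h u v - G.avg s h v = G.transfer (s + k) q u v := by
      rw [hq, transfer_sub, transfer_avg (by omega) h hv,
        transfer_of_invariant (invariant_avg s h) hv]
    rw [sq_abs, this]
    exact transfer_sq_le _ _ _ _
  have h2 : ∑ u, ∑ v ∈ G.ball k u, |G.transfer (s + k) h u v - G.avg s h v| ^ 2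
      ≤ b * (G.energy (s + k + k) h - G.energy s h) := by
    calc _ ≤ ∑ u, ∑ v ∈ G.ball k u, G.transfer (s + k) (fun x => q x ^ 2) u v :=
          Finset.sum_le_sum fun u _ => Finset.sum_le_sum fun v hv => h1 u v hv
      _ = ∑ u, ∑ v ∈ G.ball k u, q v ^ 2 := sum_ball_transfer (by omega) _
      _ ≤ b * ∑ v, q v ^ 2 := sum_ball_le hb fun v => sq_nonneg _
      _ = _ := by rw [hq, sum_sq_avg_sub (by omega)]
  have h3 : ((Finset.univ.sigma fun u => G.ball k u).card : ℝ) ≤ b * Fintype.card V := by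
    have := sum_ball_le (G := G) hb (h := fun _ => 1) (fun _ => zero_le_one)
    simpa using this
  have h4 := sq_sum_le_card_mul_sum_sq (s := Finset.univ.sigma fun u => G.ball k u)
    (f := fun p => |G.transfer (s + k) h p.1 p.2 - G.avg s h p.2|)
  rw [Finset.sum_sigma, Finset.sum_sigma] at h4
  calc _ ≤ _ := h4
    _ ≤ (b * Fintype.card V) * (b * (G.energy (s + k + k) h - G.energy s h)) := by
        refine mul_le_mul h3 h2 ?_ (by positivity)
        exact Finset.sum_nonneg fun _ _ => Finset.sum_nonneg fun _ _ => sq_nonneg _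
    _ = _ := by ring

theorem deviation_le_norm {s k b : ℕ} (hb : ∀ v, (G.ball k v).card ≤ b) (h : V → ℝ) :
    G.deviation s k h ≤ 2 * b * ∑ v, |h v| := by
  have h1 : ∑ u, ∑ v ∈ G.ball k u, G.transfer (s + k) (fun x => |h x|) u v ≤ b * ∑ v, |h v| := by
    rw [sum_ball_transfer (by omega)]
    exact sum_ball_le hb fun _ => abs_nonneg _
  have h2 : ∑ u, ∑ v ∈ G.ball k u, G.avg s (fun x => |h x|) v ≤ b * ∑ v, |h v| := by
    rw [← sum_avg (G := G) s fun x => |h x|]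
    exact sum_ball_le hb fun v => avg_nonneg (fun _ => abs_nonneg _) v
  calc _ ≤ ∑ u, ∑ v ∈ G.ball k u,
        (G.transfer (s + k) (fun x => |h x|) u v + G.avg s (fun x => |h x|) v) := by
        refine Finset.sum_le_sum fun u _ => Finset.sum_le_sum fun v _ => ?_
        exact (abs_sub _ _).trans (add_le_add (abs_transfer_le _ _ _ _) (abs_transfer_le _ _ _ _))
    _ ≤ _ := by
        simp only [Finset.sum_add_distrib]
        linarith

theorem deviation_le_add {s k b : ℕ} (hb : ∀ v, (G.ball k v).card ≤ b) (h h' : V → ℝ) :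
    G.deviation s k h ≤ G.deviation s k h' + 2 * b * ∑ v, |h v - h' v| := by
  refine le_trans ?_ (add_le_add le_rfl (deviation_le_norm (s := s) hb fun v => h v - h' v))
  unfold deviation
  rw [← Finset.sum_add_distrib]
  refine Finset.sum_le_sum fun u _ => ?_
  rw [← Finset.sum_add_distrib]
  refine Finset.sum_le_sum fun v _ => ?_
  have h2 : G.avg s (fun v => h v - h' v) v = G.avg s h v - G.avg s h' v := transfer_sub _ _ _ _ _
  rw [transfer_sub, h2]
  refine le_trans (le_of_eq ?_) (abs_add_le _ _)
  congr 1
  ring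

theorem exists_scale {b J : ℕ} {κ : ℝ} (k s₀ : ℕ) (hJ : 0 < J) (hκ : 0 ≤ κ)
    (hJκ : 2 * (b : ℝ) ^ 2 ≤ κ ^ 2 * J) (hb : ∀ v, (G.ball k v).card ≤ b) {h h' : V → ℝ}
    (h0 : ∀ v, 0 ≤ h v) (h1 : ∀ v, h v ≤ 1) (h0' : ∀ v, 0 ≤ h' v) (h1' : ∀ v, h' v ≤ 1) :
    ∃ s, s₀ ≤ s ∧ s ≤ s₀ + 2 * k * J ∧ G.deviation s k h ≤ κ * Fintype.card V ∧
      G.deviation s k h' ≤ κ * Fintype.card V := by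
  set N : ℝ := (Fintype.card V : ℝ) with hN
  have hJ' : (0 : ℝ) < J := by exact_mod_cast hJ
  set E : ℕ → ℝ := fun j => G.energy (s₀ + 2 * k * j) h + G.energy (s₀ + 2 * k * j) h' with hE
  have hsum : ∑ j ∈ Finset.range J, (E (j + 1) - E j) ≤ ∑ _j ∈ Finset.range J, 2 * N / J := by
    rw [Finset.sum_range_sub]
    have e1 : E J ≤ N + N := add_le_add (energy_le_card h0 h1) (energy_le_card h0' h1')
    have e2 : 0 ≤ E 0 := add_nonneg (energy_nonneg _ _) (energy_nonneg _ _)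
    simp only [Finset.sum_const, Finset.card_range, nsmul_eq_mul]
    rw [mul_div_cancel₀ _ hJ'.ne']
    linarith
  obtain ⟨j, hj, hjE⟩ := Finset.exists_le_of_sum_le (Finset.nonempty_range_iff.2 hJ.ne') hsum
  have hmono : ∀ f : V → ℝ, 0 ≤
      G.energy (s₀ + 2 * k * (j + 1)) f - G.energy (s₀ + 2 * k * j) f := by
    intro f
    rw [← sum_sq_avg_sub (by gcongr; omega)]
    exact Finset.sum_nonneg fun _ _ => sq_nonneg _
  have key : ∀ f : V → ℝ,
      G.energy (s₀ + 2 * k * (j + 1)) f - G.energy (s₀ + 2 * k * j) f ≤ 2 * N / J →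
      G.deviation (s₀ + 2 * k * j) k f ≤ κ * N := by
    intro f hf
    refine le_of_sq_le_sq ?_ (by positivity)
    refine (deviation_sq_le hb f).trans ?_
    rw [show s₀ + 2 * k * j + k + k = s₀ + 2 * k * (j + 1) by ring]
    calc _ ≤ (b : ℝ) ^ 2 * N * (2 * N / J) := by gcongr
      _ = 2 * (b : ℝ) ^ 2 / J * N ^ 2 := by ring
      _ ≤ κ ^ 2 * N ^ 2 := by
        gcongr
        rwa [div_le_iff₀ hJ']
      _ = _ := by ring
  have hd := hmono h
  have hd' := hmono h'
  simp only [hE] at hjE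
  refine ⟨s₀ + 2 * k * j, by omega, ?_, key h (by linarith), key h' (by linarith)⟩
  have := Finset.mem_range.1 hj
  gcongr

/-- The average over the parts `K u` and the symmetries `e` of the ball of radius `s + k` at `u` of
`∑ v ∈ K u, g v * h (e v)` is close to `∑ v ∈ A, g v * avg s h v`. -/
theorem IsPartition.abs_sum_sub_le {s k : ℕ} {A : Finset V} {K : V → Finset V}
    (hK : G.IsPartition k A K) {g : V → ℝ} (hg0 : ∀ v, 0 ≤ g v) (hg1 : ∀ v, g v ≤ 1) (h : V → ℝ) :
    |∑ u ∈ A, (∑ v ∈ K u, g v * G.transfer (s + k) h u v) / (K u).card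
      - ∑ v ∈ A, g v * G.avg s h v| ≤ G.deviation s k h := by
  rw [← hK.sum_div_card fun v => g v * G.avg s h v, ← Finset.sum_sub_distrib]
  refine (Finset.abs_sum_le_sum_abs _ _).trans ?_
  unfold deviation
  refine le_trans ?_ (Finset.sum_le_sum_of_subset_of_nonneg (Finset.subset_univ A)
    fun u _ _ => Finset.sum_nonneg fun _ _ => abs_nonneg _)
  refine Finset.sum_le_sum fun u hu => ?_
  rw [← sub_div, ← Finset.sum_sub_distrib, abs_div, Nat.abs_cast]
  have h1 : (1 : ℝ) ≤ (K u).card := by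
    exact_mod_cast Finset.card_pos.2 ⟨u, hK.mem_self u hu⟩
  refine (div_le_self (abs_nonneg _) h1).trans ?_
  refine (Finset.abs_sum_le_sum_abs _ _).trans ?_
  refine le_trans ?_ (Finset.sum_le_sum_of_subset_of_nonneg (hK.subset_ball u hu)
    fun u _ _ => abs_nonneg _)
  refine Finset.sum_le_sum fun v _ => ?_
  rw [← mul_sub, abs_mul, abs_of_nonneg (hg0 v)]
  exact mul_le_of_le_one_left (abs_nonneg _) (hg1 v)

variable [DecidableEq V]

theorem sum_mul_ind (f : V → ℝ) (T : Finset V) : ∑ v, f v * ind T v = ∑ v ∈ T, f v := by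
  simp [ind]

theorem sum_ind_mul (f : V → ℝ) (T : Finset V) : ∑ v, ind T v * f v = ∑ v ∈ T, f v := by
  simp [ind]

theorem sum_ind (T : Finset V) : ∑ v, ind T v = T.card := by
  simp [ind]

theorem sum_abs_ind_sub_le {T T' S : Finset V} (hT : T ⊆ T' ∪ S) (hT' : T' ⊆ T ∪ S) :
    ∑ v, |ind T v - ind T' v| ≤ S.card := by
  rw [← sum_ind]
  refine Finset.sum_le_sum fun v _ => ?_
  unfold ind
  have h1 := @hT v
  have h2 := @hT' v
  simp only [Finset.mem_union] at h1 h2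
  by_cases hv : v ∈ T <;> by_cases hv' : v ∈ T' <;> by_cases hs : v ∈ S <;> simp_all

/-- Two sets that are balanced at scale `s` are correlated at this scale. -/
theorem le_sum_avg_ind {s : ℕ} {β : ℝ} {P Q : Finset V}
    (hβ : ∀ c : V → ℝ, G.Invariant s c → (∀ v, |c v| ≤ 1) → ∑ v ∈ P, c v - ∑ v ∈ Q, c v ≤ β) :
    (P.card : ℝ) ^ 2 / Fintype.card V - β ≤ ∑ v ∈ P, G.avg s (ind Q) v := by
  set p := G.avg s (ind P) with hp
  have h1 : ∑ v ∈ P, G.avg s (ind Q) v = ∑ v ∈ Q, p v := by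
    rw [← sum_ind_mul, ← sum_avg_mul, sum_mul_ind]
  have h2 : ∑ v ∈ P, p v = ∑ v, p v ^ 2 := by
    have : ∑ v, p v * p v = ∑ v, ind P v * p v := by
      rw [hp, sum_avg_mul]
      simp only [avg_avg le_rfl]
    rw [← sum_ind_mul, ← this]
    exact Finset.sum_congr rfl fun v _ => by ring
  have h3 := hβ p (invariant_avg s _) fun v => by
    rw [abs_of_nonneg (avg_nonneg (ind_nonneg P) v)]
    exact avg_le_one (ind_le_one P) v
  have h4 : (P.card : ℝ) ^ 2 ≤ Fintype.card V * ∑ v, p v ^ 2 := by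
    have := sq_sum_le_card_mul_sum_sq (s := Finset.univ) (f := p)
    rwa [hp, sum_avg, sum_ind, ← hp] at this
  have h5 : (P.card : ℝ) ^ 2 / Fintype.card V ≤ ∑ v, p v ^ 2 := by
    refine div_le_of_le_mul₀ (by positivity) (Finset.sum_nonneg fun _ _ => sq_nonneg _) ?_
    linarith
  linarith

/-- There is a part `K u` and a symmetry `e` at `u` for which the number of points that are bad
(in `a`, or mapped into `b`) is small relative to the number of points of `P` mapped into `Q`. -/
theorem IsPartition.exists_piece {s k : ℕ} {A : Finset V} {K : V → Finset V}
    (hK : G.IsPartition k A K) {P Q a b : Finset V} (hP : P ⊆ A) (ha : a ⊆ A) {c : ℝ}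
    (hc : 0 ≤ c)
    (h : a.card + (b.card + G.deviation s k (ind b)) <
      c * (∑ v ∈ P, G.avg s (ind Q) v - G.deviation s k (ind Q))) :
    ∃ u ∈ A, ∃ e ∈ G.sym (s + k) u,
      (((K u).filter fun v => v ∈ a ∨ e v ∈ b).card : ℝ) <
        c * ((K u).filter fun v => v ∈ P ∧ e v ∈ Q).card := by
  have h1 := (abs_le.1 (hK.abs_sum_sub_le (s := s) (ind_nonneg P) (ind_le_one P) (ind Q))).1
  have h2 := (abs_le.1 (hK.abs_sum_sub_le (s := s) (g := fun _ => 1) (fun _ => zero_le_one)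
    (fun _ => le_rfl) (ind b))).2
  have h3 := hK.sum_div_card (ind a)
  have h4 : ∑ v ∈ A, ind P v * G.avg s (ind Q) v = ∑ v ∈ P, G.avg s (ind Q) v := by
    simp only [ind, ite_mul, one_mul, zero_mul]
    rw [← Finset.sum_filter, Finset.filter_mem_eq_inter, Finset.inter_eq_right.2 hP]
  have h5 : ∑ v ∈ A, ind a v = a.card := by
    simp only [ind]
    rw [← Finset.sum_filter, Finset.filter_mem_eq_inter, Finset.inter_eq_right.2 ha]
    simp
  have h6 : ∑ v ∈ A, (1 : ℝ) * G.avg s (ind b) v ≤ b.card := by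
    rw [← sum_ind, ← sum_avg (G := G) s (ind b)]
    simp only [one_mul]
    exact Finset.sum_le_sum_of_subset_of_nonneg (Finset.subset_univ A)
      fun v _ _ => avg_nonneg (ind_nonneg b) v
  rw [h4] at h1
  rw [h5] at h3
  have h7 : ∑ u ∈ A, ((∑ v ∈ K u, ind a v) / (K u).card
        + (∑ v ∈ K u, 1 * G.transfer (s + k) (ind b) u v) / (K u).card)
      < ∑ u ∈ A, c * ((∑ v ∈ K u, ind P v * G.transfer (s + k) (ind Q) u v) / (K u).card) := by
    rw [Finset.sum_add_distrib, ← Finset.mul_sum, h3]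
    have := mul_le_mul_of_nonneg_left h1 hc
    linarith
  obtain ⟨u, hu, hlt⟩ := Finset.exists_lt_of_sum_lt h7
  have hKpos : (0 : ℝ) < (K u).card := by
    exact_mod_cast Finset.card_pos.2 ⟨u, hK.mem_self u hu⟩
  rw [← add_div, mul_div_assoc', div_lt_div_iff_of_pos_right hKpos, transfer_sum_comm,
    transfer_sum_comm, mul_div_assoc'] at hlt
  have hS := card_sym_pos (G := G) (s + k) u
  have h8 : ∑ v ∈ K u, ind a v = (∑ _e ∈ G.sym (s + k) u, ∑ v ∈ K u, ind a v)
      / (G.sym (s + k) u).card := by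
    rw [Finset.sum_const, nsmul_eq_mul, mul_div_cancel_left₀ _ hS.ne']
  rw [h8, ← add_div, div_lt_div_iff_of_pos_right hS, ← Finset.sum_add_distrib,
    Finset.mul_sum] at hlt
  obtain ⟨e, he, hlt⟩ := Finset.exists_lt_of_sum_lt hlt
  refine ⟨u, hu, e, he, ?_⟩
  have h9 : ∑ v ∈ K u, ind P v * ind Q (e v)
      = (((K u).filter fun v => v ∈ P ∧ e v ∈ Q).card : ℝ) := by
    rw [Finset.card_filter]
    push_cast
    refine Finset.sum_congr rfl fun v _ => ?_
    unfold ind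
    by_cases h1 : v ∈ P <;> by_cases h2 : e v ∈ Q <;> simp [h1, h2]
  have h10 : (((K u).filter fun v => v ∈ a ∨ e v ∈ b).card : ℝ)
      ≤ ∑ v ∈ K u, ind a v + ∑ v ∈ K u, 1 * ind b (e v) := by
    rw [Finset.card_filter, ← Finset.sum_add_distrib]
    push_cast
    refine Finset.sum_le_sum fun v _ => ?_
    unfold ind
    by_cases h1 : v ∈ a <;> by_cases h2 : e v ∈ b <;> simp [h1, h2]
  rw [h9] at hlt
  linarith

end LocalSymmetry

namespace Database

variable {σ : Schema}

theorem gaifman_adj {D : Database σ} {a b : D.Dom} : D.gaifman.Adj a b ↔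
    a ≠ b ∧ ∃ R, ∃ t ∈ D.rel R, a ∈ Set.range t ∧ b ∈ Set.range t :=
  ⟨fun ⟨h, ⟨R, t⟩, h1, h2⟩ => ⟨h, R, t, h1, h2⟩, fun ⟨h, R, t, h1, h2⟩ => ⟨h, ⟨R, t⟩, h1, h2⟩⟩

theorem ball_zero (D : Database σ) (a : D.Dom) : D.ball 0 a = {a} := by
  ext b
  simp [ball, SimpleGraph.edist_eq_zero_iff, eq_comm (a := a)]

theorem mem_ball_comm {D : Database σ} {r : ℕ} {a b : D.Dom} :
    b ∈ D.ball r a ↔ a ∈ D.ball r b := by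
  simp [ball, SimpleGraph.edist_comm]

theorem ball_trans {D : Database σ} {r s : ℕ} {a b c : D.Dom} (h : b ∈ D.ball r a)
    (h' : c ∈ D.ball s b) : c ∈ D.ball (r + s) a := by
  simp only [ball, Set.mem_ofPred_eq] at *
  push_cast
  exact SimpleGraph.edist_triangle.trans (add_le_add h h')

theorem ball_mono {D : Database σ} {r s : ℕ} (hrs : r ≤ s) (a : D.Dom) :
    D.ball r a ⊆ D.ball s a := by
  intro b hb
  simp only [ball, Set.mem_ofPred_eq] at *
  exact hb.trans (by exact_mod_cast hrs)

theorem mem_ball_of_walk {D : Database σ} {a b : D.Dom} (w : D.gaifman.Walk a b) :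
    b ∈ D.ball w.length a := SimpleGraph.edist_le w

/-- Two elements of a tuple are at distance at most one. -/
theorem mem_ball_one_of_mem {D : Database σ} {R : σ.Rel} {t : Fin (σ.arity R) → D.Dom}
    (ht : t ∈ D.rel R) (i j : Fin (σ.arity R)) : t j ∈ D.ball 1 (t i) := by
  by_cases h : t i = t j
  · rw [h]
    exact D.mem_ball_self _ _
  · exact mem_ball_of_walk (SimpleGraph.Walk.cons
      (gaifman_adj.2 ⟨h, R, t, ht, ⟨i, rfl⟩, ⟨j, rfl⟩⟩) .nil)

theorem mem_ball_succ {D : Database σ} {r : ℕ} {a b : D.Dom} :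
    b ∈ D.ball (r + 1) a ↔
      ∃ c ∈ D.ball r a, b = c ∨ ∃ R, ∃ t ∈ D.rel R, ∃ i j, t i = c ∧ t j = b := by
  constructor
  · intro h
    simp only [ball, Set.mem_ofPred_eq] at h
    obtain ⟨w, hw⟩ := SimpleGraph.exists_walk_of_edist_ne_top (ne_top_of_le_ne_top (by simp) h)
    rw [← hw] at h
    have hl : w.length ≤ r + 1 := by exact_mod_cast h
    rcases Nat.eq_zero_or_pos w.length with h0 | h0
    · have : a = b := SimpleGraph.Walk.eq_of_length_eq_zero h0
      exact ⟨a, D.mem_ball_self _ _, Or.inl this.symm⟩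
    · have hn : ¬ w.Nil := fun h => by
        rw [← SimpleGraph.Walk.length_eq_zero_iff] at h
        omega
      have hd : w.dropLast.length + 1 = w.length := by
        have := SimpleGraph.Walk.length_dropLast_add_one hn
        exact this
      refine ⟨w.penultimate, ball_mono (by omega) _ (mem_ball_of_walk w.dropLast), Or.inr ?_⟩
      obtain ⟨-, R, t, ht, ⟨i, hi⟩, ⟨j, hj⟩⟩ := gaifman_adj.1 (w.adj_penultimate hn)
      exact ⟨R, t, ht, i, j, hi, hj⟩
  · rintro ⟨c, hc, rfl | ⟨R, t, ht, i, j, rfl, rfl⟩⟩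
    · exact ball_mono (by omega) _ hc
    · exact ball_trans hc (mem_ball_one_of_mem ht i j)

theorem mem_ball_one {D : Database σ} {a b : D.Dom} :
    b ∈ D.ball 1 a ↔ b = a ∨ ∃ R, ∃ t ∈ D.rel R, ∃ i j, t i = a ∧ t j = b := by
  rw [← zero_add 1, mem_ball_succ, ball_zero]
  simp

/-- The permutation `e` restricts to an isomorphism from the ball of radius `t` around `a` to the
ball of radius `t` around `e a`. -/
structure IsLocalSymmetry (D : Database σ) (t : ℕ) (a : D.Dom) (e : Equiv.Perm D.Dom) : Prop where
  map_mem : ∀ b ∈ D.ball t a, e b ∈ D.ball t (e a)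
  mem_of_map : ∀ b, e b ∈ D.ball t (e a) → b ∈ D.ball t a
  rel_iff : ∀ R, ∀ x : Fin (σ.arity R) → D.Dom, (∀ i, x i ∈ D.ball t a) →
    (x ∈ D.rel R ↔ e ∘ x ∈ D.rel R)

namespace IsLocalSymmetry

variable {D : Database σ} {t k : ℕ} {a b : D.Dom} {e f : Equiv.Perm D.Dom}

theorem one : D.IsLocalSymmetry t a 1 := ⟨fun _ h => h, fun _ h => h, fun _ _ _ => Iff.rfl⟩

theorem inv (h : D.IsLocalSymmetry t a e) : D.IsLocalSymmetry t (e a) e⁻¹ := by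
  refine ⟨fun b hb => ?_, fun b hb => ?_, fun R x hx => ?_⟩
  · have := h.mem_of_map (e⁻¹ b) (by simpa using hb)
    simpa using this
  · have := h.map_mem (e⁻¹ b) (by simpa using hb)
    simpa using this
  · have := h.rel_iff R (⇑e⁻¹ ∘ x) fun i => h.mem_of_map _ (by simpa using hx i)
    rw [this, ← Function.comp_assoc]
    simp

theorem mul (h : D.IsLocalSymmetry t a e) (h' : D.IsLocalSymmetry t (e a) f) :
    D.IsLocalSymmetry t a (f * e) := by
  refine ⟨fun b hb => h'.map_mem _ (h.map_mem b hb),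
    fun b hb => h.mem_of_map _ (h'.mem_of_map _ hb), fun R x hx => ?_⟩
  rw [h.rel_iff R x hx, h'.rel_iff R (e ∘ x) fun i => h.map_mem _ (hx i)]
  rfl

theorem map_mem_ball (h : D.IsLocalSymmetry (t + k) a e) (hb : b ∈ D.ball k a) {j : ℕ}
    (hj : j ≤ t) {c : D.Dom} (hc : c ∈ D.ball j b) : e c ∈ D.ball j (e b) := by
  induction j generalizing c with
  | zero =>
    rw [ball_zero] at *
    rw [hc]
    rfl
  | succ j ih =>
    obtain ⟨c', hc', rfl | ⟨R, x, hx, i, i', rfl, rfl⟩⟩ := mem_ball_succ.1 hc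
    · exact mem_ball_succ.2 ⟨_, ih (by omega) hc', Or.inl rfl⟩
    · refine mem_ball_succ.2 ⟨_, ih (by omega) hc', Or.inr ⟨R, e ∘ x, ?_, i, i', rfl, rfl⟩⟩
      refine (h.rel_iff R x fun l => ?_).1 hx
      exact ball_mono (by omega) _ (ball_trans hb (ball_trans hc' (mem_ball_one_of_mem hx i l)))

theorem map_mem_of_le (h : D.IsLocalSymmetry t a e) (hk : k ≤ t) (hb : b ∈ D.ball k a) :
    e b ∈ D.ball k (e a) :=
  map_mem_ball (k := 0) h (D.mem_ball_self _ _) hk hb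

theorem restrict (h : D.IsLocalSymmetry (t + k) a e) (hb : b ∈ D.ball k a) :
    D.IsLocalSymmetry t b e := by
  refine ⟨fun c hc => h.map_mem_ball hb le_rfl hc, fun c hc => ?_, fun R x hx => ?_⟩
  · have := h.inv.map_mem_ball (h.map_mem_of_le (by omega) hb) le_rfl hc
    simpa using this
  · refine h.rel_iff R x fun i => ?_
    rw [add_comm]
    exact ball_trans hb (hx i)

end IsLocalSymmetry

/-- The local symmetries of a database. -/
noncomputable def localSymmetry (D : Database σ) : LocalSymmetry D.Dom where
  sym t a := (Set.toFinite {e | D.IsLocalSymmetry t a e}).toFinset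
  ball t a := (Set.toFinite (D.ball t a)).toFinset
  one_mem t v := by simpa using IsLocalSymmetry.one
  inv_mem h := by simpa using IsLocalSymmetry.inv (by simpa using h)
  mul_mem h h' := by simpa using IsLocalSymmetry.mul (by simpa using h) (by simpa using h')
  mem_ball_self t v := by simpa using D.mem_ball_self t v
  ball_symm h := by simpa using mem_ball_comm.1 (by simpa using h)
  restrict h h' := by simpa using IsLocalSymmetry.restrict (by simpa using h) (by simpa using h')
  map_ball h hk h' := by
    simpa using IsLocalSymmetry.map_mem_of_le (by simpa using h) hk (by simpa using h')

theorem mem_localSymmetry_sym {D : Database σ} {t : ℕ} {a : D.Dom} {e : Equiv.Perm D.Dom} :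
    e ∈ D.localSymmetry.sym t a ↔ D.IsLocalSymmetry t a e := by
  simp [localSymmetry]

theorem mem_localSymmetry_ball {D : Database σ} {t : ℕ} {a b : D.Dom} :
    b ∈ D.localSymmetry.ball t a ↔ b ∈ D.ball t a := by
  simp [localSymmetry]

/-- Elements of the same type are related by a local symmetry. -/
theorem exists_isLocalSymmetry {D : Database σ} {t : ℕ} {a b : D.Dom}
    (h : D.typeOf t a = D.typeOf t b) : ∃ e, D.IsLocalSymmetry t a e ∧ e a = b := by
  classical
  have := Fintype.ofFinite D.Dom
  obtain ⟨e, he, hc⟩ := Quotient.exact h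
  change {x // x ∈ D.ball t a} ≃ {x // x ∈ D.ball t b} at e
  have hval : ∀ x (hx : x ∈ D.ball t a), e.extendSubtype x = e ⟨x, hx⟩ :=
    fun x hx => e.extendSubtype_apply_of_mem x hx
  have hab : e.extendSubtype a = b := by
    rw [hval a (D.mem_ball_self t a)]
    exact congrArg Subtype.val hc
  refine ⟨e.extendSubtype, ⟨fun x hx => ?_, fun x hx => ?_, fun R x hx => ?_⟩, hab⟩
  · rw [hab]
    exact e.extendSubtype_mem x hx
  · rw [hab] at hx
    by_contra hn
    exact e.extendSubtype_not_mem x hn hx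
  · have := he R fun i => ⟨x i, hx i⟩
    have hx' : ⇑e.extendSubtype ∘ x = fun i => (e ⟨x i, hx i⟩ : D.Dom) :=
      funext fun i => hval (x i) (hx i)
    rw [hx']
    exact this

/-- `ι` identifies `D` with a union of connected components of `X`. -/
structure IsComponentEmbedding (D X : Database σ) (ι : D.Dom → X.Dom) : Prop where
  injective : Function.Injective ι
  rel_iff : ∀ R (t : Fin (σ.arity R) → D.Dom), t ∈ D.rel R ↔ ι ∘ t ∈ X.rel R
  exists_of_mem : ∀ R, ∀ t ∈ X.rel R, ∀ i a, t i = ι a → ∃ s, t = ι ∘ s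

namespace IsComponentEmbedding

variable {D X : Database σ} {ι : D.Dom → X.Dom}

theorem ball_eq (h : IsComponentEmbedding D X ι) (r : ℕ) (a : D.Dom) :
    X.ball r (ι a) = ι '' D.ball r a := by
  induction r with
  | zero => simp [ball_zero]
  | succ r ih =>
    ext b
    rw [mem_ball_succ, ih]
    constructor
    · rintro ⟨_, ⟨c, hc, rfl⟩, rfl | ⟨R, t, ht, i, j, hi, rfl⟩⟩
      · exact ⟨c, mem_ball_succ.2 ⟨c, hc, Or.inl rfl⟩, rfl⟩
      · obtain ⟨s, rfl⟩ := h.exists_of_mem R t ht i c hi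
        exact ⟨s j, mem_ball_succ.2 ⟨c, hc, Or.inr ⟨R, s, (h.rel_iff R s).2 ht, i, j,
          h.injective hi, rfl⟩⟩, rfl⟩
    · rintro ⟨b, hb, rfl⟩
      obtain ⟨c, hc, rfl | ⟨R, t, ht, i, j, rfl, rfl⟩⟩ := mem_ball_succ.1 hb
      · exact ⟨_, ⟨_, hc, rfl⟩, Or.inl rfl⟩
      · exact ⟨_, ⟨_, hc, rfl⟩, Or.inr ⟨R, _, (h.rel_iff R t).1 ht, i, j, rfl, rfl⟩⟩

theorem typeOf_eq (h : IsComponentEmbedding D X ι) (r : ℕ) (a : D.Dom) :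
    X.typeOf r (ι a) = D.typeOf r a := by
  symm
  refine Quotient.sound ⟨(Equiv.Set.image ι (D.ball r a) h.injective).trans
    (Equiv.setCongr (h.ball_eq r a).symm), fun R t => ?_, rfl⟩
  exact h.rel_iff R fun i => (t i).1

theorem ncard_ball (h : IsComponentEmbedding D X ι) (r : ℕ) (a : D.Dom) :
    (X.ball r (ι a)).ncard = (D.ball r a).ncard := by
  rw [h.ball_eq, Set.ncard_image_of_injective _ h.injective]

end IsComponentEmbedding

/-- The disjoint union of two databases. -/
def sum (D E : Database σ) : Database σ where
  Dom := D.Dom ⊕ E.Dom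
  finite_dom := inferInstance
  rel R := {t | (∃ s ∈ D.rel R, t = Sum.inl ∘ s) ∨ ∃ s ∈ E.rel R, t = Sum.inr ∘ s}

theorem isComponentEmbedding_inl (D E : Database σ) :
    IsComponentEmbedding D (D.sum E) Sum.inl := by
  refine ⟨Sum.inl_injective, fun R t => ⟨fun h => Or.inl ⟨t, h, rfl⟩, ?_⟩, ?_⟩
  · rintro (⟨s, hs, h⟩ | ⟨s, hs, h⟩)
    · rwa [Sum.inl_injective.comp_left h]
    · have := congrFun h ⟨0, σ.arity_pos R⟩
      exact absurd this Sum.inl_ne_inr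
  · rintro R t (⟨s, hs, rfl⟩ | ⟨s, hs, rfl⟩) i a h
    · exact ⟨s, rfl⟩
    · simp at h

theorem isComponentEmbedding_inr (D E : Database σ) :
    IsComponentEmbedding E (D.sum E) Sum.inr := by
  refine ⟨Sum.inr_injective, fun R t => ⟨fun h => Or.inr ⟨t, h, rfl⟩, ?_⟩, ?_⟩
  · rintro (⟨s, hs, h⟩ | ⟨s, hs, h⟩)
    · have := congrFun h ⟨0, σ.arity_pos R⟩
      exact absurd this Sum.inr_ne_inl
    · rwa [Sum.inr_injective.comp_left h]
  · rintro R t (⟨s, hs, rfl⟩ | ⟨s, hs, rfl⟩) i a h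
    · simp at h
    · exact ⟨s, rfl⟩

instance (D : Database σ) : Finite D.Fact := inferInstanceAs (Finite (Σ _, _))

/-- A bound on the size of the balls of radius one. -/
theorem ncard_ball_one_le {D : Database σ} {d m : ℕ} (hD : D.DegreeLE d)
    (hm : ∀ R, σ.arity R ≤ m) (a : D.Dom) : (D.ball 1 a).ncard ≤ d * m + 1 := by
  classical
  set F := {f ∈ D.facts | a ∈ Set.range f.2} with hF
  have hFfin : F.Finite := Set.toFinite _
  have hsub : D.ball 1 a ⊆ (hFfin.toFinset.biUnion fun f => Finset.univ.image f.2) ∪ {a} := by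
    intro b hb
    rcases mem_ball_one.1 hb with rfl | ⟨R, t, ht, i, j, rfl, rfl⟩
    · simp
    · simp only [Finset.coe_biUnion, Set.mem_union, Set.mem_iUnion]
      refine Or.inl ⟨⟨R, t⟩, ?_, ?_⟩
      · simp only [Set.Finite.coe_toFinset]
        exact ⟨ht, i, rfl⟩
      · simp
  have h1 : (hFfin.toFinset.biUnion fun f : D.Fact => Finset.univ.image f.2).card ≤ d * m := by
    refine (Finset.card_biUnion_le_card_mul _ _ m fun f _ => ?_).trans ?_
    · exact Finset.card_image_le.trans (by simpa using hm f.1)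
    · have := hD a
      rw [elemDegree, ← hF, Set.ncard_eq_toFinset_card F hFfin] at this
      gcongr
  have h2 : (D.ball 1 a).ncard ≤
      ((hFfin.toFinset.biUnion fun f : D.Fact => Finset.univ.image f.2) ∪ {a}).card := by
    rw [← Set.ncard_coe_finset]
    refine Set.ncard_le_ncard ?_ (Finset.finite_toSet _)
    push_cast at hsub ⊢
    exact hsub
  refine h2.trans ((Finset.card_union_le _ _).trans ?_)
  simpa using h1

theorem ncard_ball_le {D : Database σ} {Δ : ℕ} (h : ∀ a, (D.ball 1 a).ncard ≤ Δ) (r : ℕ)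
    (a : D.Dom) : (D.ball r a).ncard ≤ Δ ^ r := by
  classical
  induction r with
  | zero => simp [ball_zero]
  | succ r ih =>
    have hfin : (D.ball r a).Finite := Set.toFinite _
    have hsub : D.ball (r + 1) a ⊆
        (hfin.toFinset.biUnion fun c => (Set.toFinite (D.ball 1 c)).toFinset) := by
      intro b hb
      obtain ⟨c, hc, h⟩ := mem_ball_succ.1 hb
      simp only [Finset.coe_biUnion, Set.mem_iUnion]
      refine ⟨c, by simpa using hc, ?_⟩
      simp only [Set.Finite.coe_toFinset]
      exact mem_ball_one.2 h
    have h2 := Set.ncard_le_ncard hsub (Finset.finite_toSet _)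
    rw [Set.ncard_coe_finset] at h2
    refine h2.trans ((Finset.card_biUnion_le_card_mul _ _ Δ fun c _ => ?_).trans ?_)
    · rw [← Set.ncard_eq_toFinset_card]
      exact h c
    · rw [← Set.ncard_eq_toFinset_card, pow_succ]
      gcongr

end Database

namespace Database

variable {σ : Schema} {X : Database σ}

theorem IsLocalSymmetry.anti {s t : ℕ} (hst : s ≤ t) {a : X.Dom} {e : Equiv.Perm X.Dom}
    (h : X.IsLocalSymmetry t a e) : X.IsLocalSymmetry s a e := by
  obtain ⟨k, rfl⟩ := Nat.exists_eq_add_of_le hst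
  exact h.restrict (X.mem_ball_self k a)

/-- `ψ` matches the elements of `U ⊆ A` with elements outside `A` of the same `s`-type. -/
structure IsMatching (X : Database σ) (A : Finset X.Dom) (s : ℕ) (U : Finset X.Dom)
    (ψ : X.Dom → X.Dom) : Prop where
  subset : U ⊆ A
  notMem : ∀ v ∈ U, ψ v ∉ A
  injOn : Set.InjOn ψ U
  exists_symmetry : ∀ v ∈ U, ∃ e, X.IsLocalSymmetry s v e ∧ e v = ψ v

theorem IsMatching.anti {A U : Finset X.Dom} {s t : ℕ} (hst : s ≤ t) {ψ : X.Dom → X.Dom}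
    (h : X.IsMatching A t U ψ) : X.IsMatching A s U ψ :=
  ⟨h.subset, h.notMem, h.injOn, fun v hv =>
    let ⟨e, he, hv⟩ := h.exists_symmetry v hv
    ⟨e, he.anti hst, hv⟩⟩

/-- The matching `ψ` respects all tuples containing `v` or `ψ v`. -/
structure IsGood (X : Database σ) (U : Finset X.Dom) (ψ : X.Dom → X.Dom) (v : X.Dom) : Prop where
  rel_map : ∀ R, ∀ t ∈ X.rel R, ∀ i, t i = v → (∀ j, t j ∈ U) ∧ ψ ∘ t ∈ X.rel R
  rel_of_map : ∀ R, ∀ t ∈ X.rel R, ∀ i, t i = ψ v → ∃ x ∈ X.rel R, (∀ j, x j ∈ U) ∧ t = ψ ∘ x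

theorem IsGood.mono {U U' : Finset X.Dom} {ψ ψ' : X.Dom → X.Dom} {v : X.Dom}
    (h : X.IsGood U ψ v) (hU : U ⊆ U') (hψ : ∀ w ∈ U, ψ' w = ψ w) (hv : v ∈ U) :
    X.IsGood U' ψ' v := by
  have hcomp : ∀ {R} {t : Fin (σ.arity R) → X.Dom}, (∀ j, t j ∈ U) → ψ' ∘ t = ψ ∘ t :=
    fun ht => funext fun j => hψ _ (ht j)
  refine ⟨fun R t ht i hi => ?_, fun R t ht i hi => ?_⟩
  · obtain ⟨h1, h2⟩ := h.rel_map R t ht i hi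
    exact ⟨fun j => hU (h1 j), by rwa [hcomp h1]⟩
  · rw [hψ v hv] at hi
    obtain ⟨x, h1, h2, h3⟩ := h.rel_of_map R t ht i hi
    exact ⟨x, h1, fun j => hU (h2 j), by rwa [hcomp h2]⟩

open Classical in
/-- The matched elements at which the matching fails to be a local isomorphism. -/
noncomputable def bad (X : Database σ) (U : Finset X.Dom) (ψ : X.Dom → X.Dom) : Finset X.Dom :=
  U.filter fun v => ¬ X.IsGood U ψ v

open Classical in
/-- The elements of `T` that are equal or adjacent to an element of `W`. -/
noncomputable def touching (X : Database σ) (T W : Finset X.Dom) : Finset X.Dom :=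
  T.filter fun v => ∃ w ∈ W, w ∈ X.ball 1 v

theorem mem_bad {U : Finset X.Dom} {ψ : X.Dom → X.Dom} {v : X.Dom} :
    v ∈ X.bad U ψ ↔ v ∈ U ∧ ¬ X.IsGood U ψ v := by
  simp [bad]

theorem mem_touching {T W : Finset X.Dom} {v : X.Dom} :
    v ∈ X.touching T W ↔ v ∈ T ∧ ∃ w ∈ W, w ∈ X.ball 1 v := by
  simp [touching]

theorem touching_subset (T W : Finset X.Dom) : X.touching T W ⊆ T :=
  fun _ hv => (mem_touching.1 hv).1

theorem card_biUnion_ball_le [DecidableEq X.Dom] {Δ : ℕ} (hΔ : ∀ v, (X.ball 1 v).ncard ≤ Δ)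
    (S : Finset X.Dom) : (S.biUnion fun v => X.localSymmetry.ball 1 v).card ≤ S.card * Δ := by
  refine Finset.card_biUnion_le_card_mul _ _ Δ fun v _ => ?_
  change (Set.toFinite (X.ball 1 v)).toFinset.card ≤ Δ
  rw [← Set.ncard_eq_toFinset_card]
  exact hΔ v

/-- `A` is a union of connected components. -/
def IsUnionOfComponents (X : Database σ) (A : Finset X.Dom) : Prop :=
  ∀ R, ∀ t ∈ X.rel R, ∀ i j, t i ∈ A → t j ∈ A

theorem IsUnionOfComponents.mem_iff {A : Finset X.Dom} (hA : X.IsUnionOfComponents A)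
    {v w : X.Dom} (h : w ∈ X.ball 1 v) : w ∈ A ↔ v ∈ A := by
  rcases mem_ball_one.1 h with rfl | ⟨R, t, ht, i, j, rfl, rfl⟩
  · rfl
  · exact ⟨hA R t ht j i, hA R t ht i j⟩

variable [DecidableEq X.Dom] {A U : Finset X.Dom} {ψ : X.Dom → X.Dom} {s k Δ : ℕ}

theorem card_touching_left_le (hΔ : ∀ v, (X.ball 1 v).ncard ≤ Δ) :
    (X.touching (A \ U) U).card ≤ (X.bad U ψ).card * Δ := by
  refine (Finset.card_le_card ?_).trans (card_biUnion_ball_le hΔ _)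
  intro v hv
  obtain ⟨hv, w, hw, hwv⟩ := mem_touching.1 hv
  have hvU := (Finset.mem_sdiff.1 hv).2
  refine Finset.mem_biUnion.2 ⟨w, mem_bad.2 ⟨hw, fun hg => ?_⟩,
    mem_localSymmetry_ball.2 (mem_ball_comm.1 hwv)⟩
  rcases mem_ball_one.1 hwv with rfl | ⟨R, t, ht, i, j, rfl, rfl⟩
  · exact hvU hw
  · exact hvU ((hg.rel_map R t ht j rfl).1 i)

theorem card_touching_right_le {T : Finset X.Dom} (hΔ : ∀ v, (X.ball 1 v).ncard ≤ Δ) :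
    (X.touching (T \ U.image ψ) (U.image ψ)).card ≤ (X.bad U ψ).card * Δ := by
  refine (Finset.card_le_card ?_).trans ((card_biUnion_ball_le hΔ ((X.bad U ψ).image ψ)).trans
    (Nat.mul_le_mul_right _ Finset.card_image_le))
  intro v hv
  obtain ⟨hv, w, hw, hwv⟩ := mem_touching.1 hv
  have hvU := (Finset.mem_sdiff.1 hv).2
  obtain ⟨z, hz, rfl⟩ := Finset.mem_image.1 hw
  refine Finset.mem_biUnion.2 ⟨ψ z, Finset.mem_image_of_mem _ (mem_bad.2 ⟨hz, fun hg => ?_⟩),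
    mem_localSymmetry_ball.2 (mem_ball_comm.1 hwv)⟩
  rcases mem_ball_one.1 hwv with h | ⟨R, t, ht, i, j, rfl, hj⟩
  · exact hvU (h ▸ hw)
  · obtain ⟨x, -, hx, rfl⟩ := hg.rel_of_map R t ht j hj
    exact hvU (Finset.mem_image_of_mem _ (hx i))

/-- The part of `K` on which the symmetry `e` extends a matching. -/
def piece (A U : Finset X.Dom) (ψ : X.Dom → X.Dom) (K : Finset X.Dom) (e : Equiv.Perm X.Dom)
    [Fintype X.Dom] : Finset X.Dom :=
  K.filter fun v => v ∈ A \ U ∧ e v ∈ Aᶜ \ U.image ψ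

theorem IsMatching.sum_image (h : X.IsMatching A s U ψ) {c : X.Dom → ℝ}
    (hc : X.localSymmetry.Invariant s c) : ∑ v ∈ U.image ψ, c v = ∑ v ∈ U, c v := by
  rw [Finset.sum_image h.injOn]
  refine Finset.sum_congr rfl fun v hv => ?_
  obtain ⟨e, he, hev⟩ := h.exists_symmetry v hv
  rw [← hev]
  exact hc v e (mem_localSymmetry_sym.2 he)

variable [Fintype X.Dom]

theorem mem_piece {K : Finset X.Dom} {e : Equiv.Perm X.Dom} {v : X.Dom} :
    v ∈ piece A U ψ K e ↔ v ∈ K ∧ (v ∈ A ∧ v ∉ U) ∧ e v ∉ A ∧ e v ∉ U.image ψ := by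
  simp [piece]

theorem IsMatching.extend (h : X.IsMatching A s U ψ) {K : Finset X.Dom} {e : Equiv.Perm X.Dom}
    {u : X.Dom} (he : X.IsLocalSymmetry (s + k) u e) (hK : ∀ v ∈ K, v ∈ X.ball k u) :
    X.IsMatching A s (U ∪ piece A U ψ K e) ((piece A U ψ K e).piecewise e ψ) := by
  set Q := piece A U ψ K e with hQ
  have hdisj : ∀ v ∈ U, v ∉ Q := fun v hv hvQ => (mem_piece.1 hvQ).2.1.2 hv
  have hU : ∀ v ∈ U, Q.piecewise e ψ v = ψ v := fun v hv =>
    Finset.piecewise_eq_of_notMem _ _ _ (hdisj v hv)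
  have hQ' : ∀ v ∈ Q, Q.piecewise e ψ v = e v := fun v hv =>
    Finset.piecewise_eq_of_mem _ _ _ hv
  refine ⟨?_, ?_, ?_, ?_⟩
  · exact Finset.union_subset h.subset fun v hv => (mem_piece.1 hv).2.1.1
  · intro v hv
    rcases Finset.mem_union.1 hv with hv | hv
    · rw [hU v hv]
      exact h.notMem v hv
    · rw [hQ' v hv]
      exact (mem_piece.1 hv).2.2.1
  · intro v hv w hw hvw
    rcases Finset.mem_union.1 (Finset.mem_coe.1 hv) with hv | hv <;>
      rcases Finset.mem_union.1 (Finset.mem_coe.1 hw) with hw | hw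
    · rw [hU v hv, hU w hw] at hvw
      exact h.injOn hv hw hvw
    · rw [hU v hv, hQ' w hw] at hvw
      exact absurd (hvw ▸ Finset.mem_image_of_mem ψ hv) (mem_piece.1 hw).2.2.2
    · rw [hQ' v hv, hU w hw] at hvw
      exact absurd (hvw ▸ Finset.mem_image_of_mem ψ hw) (mem_piece.1 hv).2.2.2
    · rw [hQ' v hv, hQ' w hw] at hvw
      exact e.injective hvw
  · intro v hv
    rcases Finset.mem_union.1 hv with hv | hv
    · rw [hU v hv]
      exact h.exists_symmetry v hv
    · rw [hQ' v hv]
      exact ⟨e, he.restrict (hK v (mem_piece.1 hv).1), rfl⟩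

theorem bad_extend_subset (hA : X.IsUnionOfComponents A) {K : Finset X.Dom}
    {e : Equiv.Perm X.Dom} {u : X.Dom} (hs : 1 ≤ s) (he : X.IsLocalSymmetry (s + k) u e)
    (hK : ∀ v ∈ K, v ∈ X.ball k u) {a : Finset X.Dom}
    (ha : ∀ v ∈ K, v ∉ a → X.ball 1 v ⊆ K) :
    X.bad (U ∪ piece A U ψ K e) ((piece A U ψ K e).piecewise e ψ) ⊆ X.bad U ψ ∪
      K.filter fun v => v ∈ a ∪ X.touching (A \ U) U ∨
        e v ∈ X.touching (Aᶜ \ U.image ψ) (U.image ψ) := by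
  set Q := piece A U ψ K e with hQ
  have hdisj : ∀ v ∈ U, v ∉ Q := fun v hv hvQ => (mem_piece.1 hvQ).2.1.2 hv
  intro v hv
  obtain ⟨hv, hbad⟩ := mem_bad.1 hv
  by_contra hn
  refine hbad ?_
  rw [Finset.mem_union, not_or] at hn
  obtain ⟨hn1, hn2⟩ := hn
  rcases Finset.mem_union.1 hv with hvU | hvQ
  · rw [mem_bad, not_and, not_not] at hn1
    exact (hn1 hvU).mono Finset.subset_union_left
      (fun w hw => Finset.piecewise_eq_of_notMem _ _ _ (hdisj w hw)) hvU
  · obtain ⟨hvK, ⟨hvA, hvU⟩, heA, heU⟩ := mem_piece.1 hvQ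
    simp only [Finset.mem_filter, hvK, true_and, Finset.mem_union, not_or, mem_touching,
      Finset.mem_sdiff, Finset.mem_compl, hvA, hvU, heA, heU, not_false_eq_true, and_self,
      not_exists, not_and] at hn2
    obtain ⟨⟨hva, hv1⟩, hv2⟩ := hn2
    have hsym : X.IsLocalSymmetry 1 v e := (he.restrict (hK v hvK)).anti hs
    have hball : ∀ w ∈ X.ball 1 v, w ∈ Q := by
      intro w hw
      have hew := hsym.map_mem w hw
      exact mem_piece.2 ⟨ha v hvK hva hw, ⟨(hA.mem_iff hw).2 hvA, fun h => hv1 w h hw⟩,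
        fun h => heA ((hA.mem_iff hew).1 h), fun h => hv2 _ h hew⟩
    have hcomp : ∀ {R} {t : Fin (σ.arity R) → X.Dom}, (∀ j, t j ∈ X.ball 1 v) →
        Q.piecewise e ψ ∘ t = e ∘ t :=
      fun ht => funext fun j => Finset.piecewise_eq_of_mem _ _ _ (hball _ (ht j))
    refine ⟨fun R t ht i hi => ?_, fun R t ht i hi => ?_⟩
    · have hb : ∀ j, t j ∈ X.ball 1 v := fun j => hi ▸ mem_ball_one_of_mem ht i j
      refine ⟨fun j => Finset.mem_union_right _ (hball _ (hb j)), ?_⟩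
      rw [hcomp hb]
      exact (hsym.rel_iff R t hb).1 ht
    · rw [Finset.piecewise_eq_of_mem _ _ _ hvQ] at hi
      have hb : ∀ j, (⇑e⁻¹ ∘ t : Fin (σ.arity R) → X.Dom) j ∈ X.ball 1 v := fun j => by
        refine hsym.mem_of_map _ ?_
        simpa [hi] using mem_ball_one_of_mem ht i j
      have het : (e ∘ (⇑e⁻¹ ∘ t) : Fin (σ.arity R) → X.Dom) = t := by
        funext j
        simp
      refine ⟨_, (hsym.rel_iff R _ hb).2 (by rwa [het]),
        fun j => Finset.mem_union_right _ (hball _ (hb j)), ?_⟩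
      rw [hcomp hb, het]

theorem IsMatching.image_subset (h : X.IsMatching A s U ψ) : U.image ψ ⊆ Aᶜ := by
  intro v hv
  obtain ⟨w, hw, rfl⟩ := Finset.mem_image.1 hv
  exact Finset.mem_compl.2 (h.notMem w hw)

/-- `A` and its complement have almost the same numbers of elements of every `s`-type. -/
def IsBalanced (X : Database σ) [Fintype X.Dom] [DecidableEq X.Dom] (A : Finset X.Dom) (s : ℕ)
    (β : ℝ) : Prop :=
  ∀ c : X.Dom → ℝ, X.localSymmetry.Invariant s c → (∀ v, |c v| ≤ 1) →
    ∑ v ∈ A, c v - ∑ v ∈ Aᶜ, c v ≤ β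

theorem IsBalanced.anti {t : ℕ} {β : ℝ} (hst : s ≤ t) (h : X.IsBalanced A t β) :
    X.IsBalanced A s β := fun c hc => h c (hc.mono hst)

theorem IsMatching.extend_of_deviation_le (h : X.IsMatching A s U ψ)
    (hA : X.IsUnionOfComponents A) {K : X.Dom → Finset X.Dom}
    (hK : X.localSymmetry.IsPartition k A K) {a : Finset X.Dom} (haA : a ⊆ A)
    (ha : ∀ v ∈ A, v ∉ a → X.ball 1 v ⊆ K v) (hs : 1 ≤ s)
    (hΔ : ∀ v, (X.ball 1 v).ncard ≤ Δ) (hΔ1 : 1 ≤ Δ) {x κ : ℝ} (hx : 0 < x) (hκ : 0 < κ)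
    (hκx : 2 * κ ≤ x ^ 2 / 2)
    (hbal : X.IsBalanced A s (κ * Fintype.card X.Dom))
    (hacard : (a.card : ℝ) ≤ κ * Fintype.card X.Dom)
    (hrem : x * Fintype.card X.Dom < (A \ U).card)
    (hdev : X.localSymmetry.deviation s k (LocalSymmetry.ind (Aᶜ \ U.image ψ)) ≤
      κ * Fintype.card X.Dom)
    (hdev' : X.localSymmetry.deviation s k
      (LocalSymmetry.ind (X.touching (Aᶜ \ U.image ψ) (U.image ψ))) ≤ κ * Fintype.card X.Dom) :
    ∃ U' ψ', X.IsMatching A s U' ψ' ∧ U ⊆ U' ∧ (∀ v ∈ U, ψ' v = ψ v) ∧ U.card < U'.card ∧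
      ((X.bad U' ψ').card : ℝ) ≤ (X.bad U ψ).card + 4 * Δ / x ^ 2 *
        (κ + (X.bad U ψ).card / Fintype.card X.Dom) * ((U'.card : ℝ) - U.card) := by
  set N : ℝ := (Fintype.card X.Dom : ℝ) with hN
  set Z : ℝ := ((X.bad U ψ).card : ℝ) with hZ
  have hN0 : 0 < N := by
    have : (A \ U).card ≤ Fintype.card X.Dom := Finset.card_le_univ _
    rcases Nat.eq_zero_or_pos (Fintype.card X.Dom) with h0 | h0
    · rw [hN, h0] at hrem
      rw [h0, Nat.le_zero] at this
      rw [this] at hrem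
      simp at hrem
    · exact Nat.cast_pos.2 h0
  have hΔ1' : (1 : ℝ) ≤ Δ := by exact_mod_cast hΔ1
  set c : ℝ := 4 * Δ / x ^ 2 * (κ + Z / N) with hc
  have hc0 : 0 < c := by positivity
  have hcorr := LocalSymmetry.le_sum_avg_ind (G := X.localSymmetry) (s := s) (β := κ * N)
    (P := A \ U) (Q := Aᶜ \ U.image ψ) (by
      intro c hc hc1
      rw [Finset.sum_sdiff_eq_sub h.subset, Finset.sum_sdiff_eq_sub h.image_subset,
        h.sum_image hc]
      have := hbal c hc hc1
      linarith)
  have hsq : x ^ 2 * N < ((A \ U).card : ℝ) ^ 2 / N := by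
    rw [lt_div_iff₀ hN0]
    calc x ^ 2 * N * N = (x * N) ^ 2 := by ring
      _ < _ := by gcongr
  have ht1 : ((X.touching (A \ U) U).card : ℝ) ≤ Z * Δ := by
    have := card_touching_left_le (A := A) (U := U) (ψ := ψ) hΔ
    rw [hZ]
    exact_mod_cast this
  have ht2 : ((X.touching (Aᶜ \ U.image ψ) (U.image ψ)).card : ℝ) ≤ Z * Δ := by
    have := card_touching_right_le (U := U) (ψ := ψ) (T := Aᶜ) hΔ
    rw [hZ]
    exact_mod_cast this
  have hacard' : ((a ∪ X.touching (A \ U) U).card : ℝ) ≤ κ * N + Z * Δ := by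
    have : ((a ∪ X.touching (A \ U) U).card : ℝ) ≤ a.card + (X.touching (A \ U) U).card := by
      exact_mod_cast Finset.card_union_le _ _
    linarith
  have hcx : c * (x ^ 2 / 2 * N) = 2 * Δ * (κ * N + Z) := by
    rw [hc]
    field_simp
    ring
  have hlt : ((a ∪ X.touching (A \ U) U).card : ℝ) +
      ((X.touching (Aᶜ \ U.image ψ) (U.image ψ)).card + X.localSymmetry.deviation s k
        (LocalSymmetry.ind (X.touching (Aᶜ \ U.image ψ) (U.image ψ)))) <
      c * (∑ v ∈ A \ U, X.localSymmetry.avg s (LocalSymmetry.ind (Aᶜ \ U.image ψ)) v -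
        X.localSymmetry.deviation s k (LocalSymmetry.ind (Aᶜ \ U.image ψ))) := by
    have h1 : x ^ 2 / 2 * N < ∑ v ∈ A \ U, X.localSymmetry.avg s
        (LocalSymmetry.ind (Aᶜ \ U.image ψ)) v -
        X.localSymmetry.deviation s k (LocalSymmetry.ind (Aᶜ \ U.image ψ)) := by
      have : 2 * κ * N ≤ x ^ 2 / 2 * N := by gcongr
      linarith
    have h2 := mul_lt_mul_of_pos_left h1 hc0
    rw [hcx] at h2
    have h3 : κ * N ≤ Δ * (κ * N) := le_mul_of_one_le_left (by positivity) hΔ1'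
    nlinarith
  obtain ⟨u, hu, e, he, hlt⟩ := hK.exists_piece Finset.sdiff_subset
    (Finset.union_subset haA ((touching_subset _ _).trans Finset.sdiff_subset)) hc0.le hlt
  rw [mem_localSymmetry_sym] at he
  have hball : ∀ v ∈ K u, v ∈ X.ball k u := fun v hv =>
    mem_localSymmetry_ball.1 (hK.subset_ball u hu hv)
  have hQ := h.extend he hball
  have hbad := bad_extend_subset (ψ := ψ) (U := U) hA hs he hball (a := a) fun v hv hva => by
    rw [← hK.eq_of_mem u hu v hv]
    exact ha v (hK.subset u hu hv) hva
  have hdisj : Disjoint U (piece A U ψ (K u) e) :=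
    Finset.disjoint_left.2 fun v hv hvQ => (mem_piece.1 hvQ).2.1.2 hv
  change _ < c * ((piece A U ψ (K u) e).card : ℝ) at hlt
  have hpos : 0 < (piece A U ψ (K u) e).card := by
    by_contra h0
    rw [Nat.eq_zero_of_not_pos h0] at hlt
    simp only [Nat.cast_zero, mul_zero] at hlt
    exact absurd hlt (not_lt.2 (Nat.cast_nonneg _))
  refine ⟨_, _, hQ, Finset.subset_union_left, fun v hv => Finset.piecewise_eq_of_notMem _ _ _
    (Finset.disjoint_left.1 hdisj hv), ?_, ?_⟩
  · rw [Finset.card_union_of_disjoint hdisj]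
    omega
  · rw [Finset.card_union_of_disjoint hdisj]
    have h1 := (Finset.card_le_card hbad).trans (Finset.card_union_le _ _)
    have h2 : ((X.bad (U ∪ piece A U ψ (K u) e)
        ((piece A U ψ (K u) e).piecewise e ψ)).card : ℝ) ≤ _ := Nat.cast_le.2 h1
    push_cast at h2 ⊢
    rw [add_sub_cancel_left]
    linarith

end Database

namespace Database

variable {σ : Schema} {X : Database σ} [Fintype X.Dom] {A U U₀ : Finset X.Dom}
  {ψ ψ₀ : X.Dom → X.Dom} {s k Δ b : ℕ}

/-- The number of matched elements at which the matching is not a local isomorphism is small,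
relative to the number of matched elements. -/
def HasFewBad (X : Database σ) [Fintype X.Dom] (κ C : ℝ) (U : Finset X.Dom) (ψ : X.Dom → X.Dom) :
    Prop :=
  κ + (X.bad U ψ).card / (Fintype.card X.Dom : ℝ) ≤ κ * Real.exp (C * (U.card / Fintype.card X.Dom))

theorem HasFewBad.extend {κ C : ℝ} (h : X.HasFewBad κ C U₀ ψ₀) (hκ : 0 < κ)
    (hbad : ((X.bad U ψ).card : ℝ) ≤ (X.bad U₀ ψ₀).card + C *
        (κ + (X.bad U₀ ψ₀).card / Fintype.card X.Dom) * ((U.card : ℝ) - U₀.card)) :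
    X.HasFewBad κ C U ψ := by
  unfold HasFewBad at *
  set N : ℝ := (Fintype.card X.Dom : ℝ) with hN
  have hN0 : 0 ≤ N := Nat.cast_nonneg _
  set z := κ + (X.bad U₀ ψ₀).card / N with hz
  have hz0 : 0 ≤ z := by positivity
  set q : ℝ := C * ((U.card - U₀.card) / N) with hq
  have h1 : κ + (X.bad U ψ).card / N ≤ z * (1 + q) := by
    have := div_le_div_of_nonneg_right hbad hN0
    calc _ ≤ κ + ((X.bad U₀ ψ₀).card + C * z * ((U.card : ℝ) - U₀.card)) / N := by gcongr
      _ = z + z * (C * ((U.card - U₀.card) / N)) := by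
        rw [hz]
        ring
      _ = _ := by
        rw [hq]
        ring
  calc _ ≤ z * (1 + q) := h1
    _ ≤ z * Real.exp q := by
      gcongr
      linarith [Real.add_one_le_exp q]
    _ ≤ (κ * Real.exp (C * (U₀.card / N))) * Real.exp q := by gcongr
    _ = κ * Real.exp (C * (U.card / N)) := by
      rw [mul_assoc, ← Real.exp_add, hq]
      congr 2
      ring

variable [DecidableEq X.Dom]

theorem sum_abs_ind_compl_sub_le (hU : U₀ ⊆ U) (B : Finset X.Dom) :
    ∑ v, |LocalSymmetry.ind (B \ U) v - LocalSymmetry.ind (B \ U₀) v| ≤ (U \ U₀).card := by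
  refine LocalSymmetry.sum_abs_ind_sub_le ?_ ?_
  · exact (Finset.sdiff_subset_sdiff le_rfl hU).trans Finset.subset_union_left
  · intro v hv
    have := @hU v
    simp only [Finset.mem_sdiff, Finset.mem_union] at hv ⊢
    tauto

theorem sum_abs_ind_touching_sub_le (hΔ : ∀ v, (X.ball 1 v).ncard ≤ Δ) (hU : U₀ ⊆ U)
    (B : Finset X.Dom) :
    ∑ v, |LocalSymmetry.ind (X.touching (B \ U) U) v
      - LocalSymmetry.ind (X.touching (B \ U₀) U₀) v| ≤ (U \ U₀).card * Δ := by
  have hb : (((U \ U₀).biUnion fun v => X.localSymmetry.ball 1 v).card : ℝ) ≤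
      (U \ U₀).card * Δ := by
    exact_mod_cast card_biUnion_ball_le hΔ (U \ U₀)
  refine le_trans (LocalSymmetry.sum_abs_ind_sub_le ?_ ?_) hb
  · intro v hv
    obtain ⟨hv, w, hw, hwv⟩ := mem_touching.1 hv
    rw [Finset.mem_sdiff] at hv
    rw [Finset.mem_union]
    by_cases hw0 : w ∈ U₀
    · exact Or.inl (mem_touching.2 ⟨Finset.mem_sdiff.2 ⟨hv.1, fun h => hv.2 (hU h)⟩, w, hw0, hwv⟩)
    · exact Or.inr (Finset.mem_biUnion.2 ⟨w, Finset.mem_sdiff.2 ⟨hw, hw0⟩,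
        mem_localSymmetry_ball.2 (mem_ball_comm.1 hwv)⟩)
  · intro v hv
    obtain ⟨hv, w, hw, hwv⟩ := mem_touching.1 hv
    rw [Finset.mem_sdiff] at hv
    rw [Finset.mem_union]
    by_cases hvU : v ∈ U
    · exact Or.inr (Finset.mem_biUnion.2 ⟨v, Finset.mem_sdiff.2 ⟨hvU, hv.2⟩,
        mem_localSymmetry_ball.2 (X.mem_ball_self 1 v)⟩)
    · exact Or.inl (mem_touching.2 ⟨Finset.mem_sdiff.2 ⟨hv.1, hvU⟩, w, hU hw, hwv⟩)

/-- One phase of the construction: a matching is enlarged by at least `δ |X|` elements, or until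
almost all elements of `A` are matched. -/
theorem IsMatching.exists_phase {t J : ℕ} (h : X.IsMatching A (s + 2 * k * J) U₀ ψ₀)
    (hA : X.IsUnionOfComponents A) {K : X.Dom → Finset X.Dom}
    (hK : X.localSymmetry.IsPartition k A K) {a : Finset X.Dom} (haA : a ⊆ A)
    (ha : ∀ v ∈ A, v ∉ a → X.ball 1 v ⊆ K v) (hs : 1 ≤ s)
    (hΔ : ∀ v, (X.ball 1 v).ncard ≤ Δ) (hΔ1 : 1 ≤ Δ)
    (hb : ∀ v, (X.localSymmetry.ball k v).card ≤ b) {x κ δ : ℝ} (hx : 0 < x) (hκ : 0 < κ)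
    (hκx : 2 * κ ≤ x ^ 2 / 2) (hJ : 0 < J) (hJκ : 2 * (b : ℝ) ^ 2 ≤ (κ / 2) ^ 2 * J)
    (hδκ : 2 * b * (δ * Δ) ≤ κ / 2)
    (hst : s + 2 * k * J ≤ t) (hbal : X.IsBalanced A t (κ * Fintype.card X.Dom))
    (hacard : (a.card : ℝ) ≤ κ * Fintype.card X.Dom)
    (hbad : X.HasFewBad κ (4 * Δ / x ^ 2) U₀ ψ₀) :
    ∃ U ψ, X.IsMatching A s U ψ ∧ X.HasFewBad κ (4 * Δ / x ^ 2) U ψ ∧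
      (((A \ U).card : ℝ) ≤ x * Fintype.card X.Dom ∨
        (U₀.card : ℝ) + δ * Fintype.card X.Dom ≤ U.card) := by
  obtain ⟨s', hs', hs't, hdev, hdev'⟩ := LocalSymmetry.exists_scale (G := X.localSymmetry) k s hJ
    (by positivity : 0 ≤ κ / 2) hJκ hb (LocalSymmetry.ind_nonneg (Aᶜ \ U₀.image ψ₀))
    (LocalSymmetry.ind_le_one _)
    (LocalSymmetry.ind_nonneg (X.touching (Aᶜ \ U₀.image ψ₀) (U₀.image ψ₀)))
    (LocalSymmetry.ind_le_one _)
  set N : ℝ := (Fintype.card X.Dom : ℝ) with hN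
  have hN0 : 0 ≤ N := Nat.cast_nonneg _
  have key : ∀ n : ℕ, ∃ U ψ, X.IsMatching A s' U ψ ∧ X.HasFewBad κ (4 * Δ / x ^ 2) U ψ ∧
      U₀ ⊆ U ∧ (∀ v ∈ U₀, ψ v = ψ₀ v) ∧ (((A \ U).card : ℝ) ≤ x * N ∨
        (U₀.card : ℝ) + δ * N ≤ U.card ∨ n ≤ U.card) := by
    intro n
    induction n with
    | zero => exact ⟨U₀, ψ₀, h.anti hs't, hbad, subset_rfl, fun _ _ => rfl, by simp⟩
    | succ n ih =>
      obtain ⟨U, ψ, hm, hfew, hsub, heq, hor⟩ := ih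
      by_cases h1 : ((A \ U).card : ℝ) ≤ x * N
      · exact ⟨U, ψ, hm, hfew, hsub, heq, Or.inl h1⟩
      by_cases h2 : (U₀.card : ℝ) + δ * N ≤ U.card
      · exact ⟨U, ψ, hm, hfew, hsub, heq, Or.inr (Or.inl h2)⟩
      have h3 : n ≤ U.card := (hor.resolve_left h1).resolve_left h2
      rw [not_le] at h1 h2
      have himg : U₀.image ψ₀ ⊆ U.image ψ := by
        intro v hv
        obtain ⟨w, hw, rfl⟩ := Finset.mem_image.1 hv
        exact Finset.mem_image.2 ⟨w, hsub hw, heq w hw⟩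
      have hcard : ((U.image ψ \ U₀.image ψ₀).card : ℝ) ≤ δ * N := by
        have h4 := Finset.card_sdiff_add_card_eq_card himg
        rw [Finset.card_image_of_injOn hm.injOn, Finset.card_image_of_injOn h.injOn] at h4
        have h5 : ((U.image ψ \ U₀.image ψ₀).card : ℝ) + U₀.card = U.card := by exact_mod_cast h4
        linarith
      have hΔ1' : (1 : ℝ) ≤ Δ := by exact_mod_cast hΔ1
      have hcardΔ : ((U.image ψ \ U₀.image ψ₀).card : ℝ) * Δ ≤ δ * Δ * N := by
        calc _ ≤ δ * N * Δ := by gcongr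
          _ = _ := by ring
      have hcard' : ((U.image ψ \ U₀.image ψ₀).card : ℝ) ≤ δ * Δ * N :=
        le_trans (le_mul_of_one_le_right (Nat.cast_nonneg _) hΔ1') hcardΔ
      have hbN : 2 * (b : ℝ) * (δ * Δ * N) ≤ κ / 2 * N := by
        calc _ = 2 * b * (δ * Δ) * N := by ring
          _ ≤ _ := by gcongr
      have hb0 : (0 : ℝ) ≤ 2 * b := by positivity
      obtain ⟨U', ψ', hm', hsub', heq', hlt, hbad'⟩ := hm.extend_of_deviation_le hA hK haA ha
        (hs.trans hs') hΔ hΔ1 hx hκ hκx (hbal.anti (hs't.trans hst)) hacard h1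
        (by
          refine (LocalSymmetry.deviation_le_add hb _ _).trans
            ((add_le_add hdev (mul_le_mul_of_nonneg_left
              ((sum_abs_ind_compl_sub_le himg _).trans hcard') hb0)).trans ?_)
          linarith)
        (by
          refine (LocalSymmetry.deviation_le_add hb _ _).trans
            ((add_le_add hdev' (mul_le_mul_of_nonneg_left
              ((sum_abs_ind_touching_sub_le hΔ himg _).trans hcardΔ) hb0)).trans ?_)
          linarith)
      exact ⟨U', ψ', hm', hfew.extend hκ hbad', hsub.trans hsub',
        fun v hv => (heq' v (hsub hv)).trans (heq v hv), Or.inr (Or.inr (by omega))⟩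
  obtain ⟨U, ψ, hm, hfew, -, -, hor⟩ := key (Fintype.card X.Dom + 1)
  refine ⟨U, ψ, hm.anti hs', hfew, ?_⟩
  rcases hor with h1 | h1 | h1
  · exact Or.inl h1
  · exact Or.inr h1
  · have := Finset.card_le_univ U
    omega

/-- If `A` has a partition into parts of bounded radius with few tuples between different parts, and
`A` and its complement have almost the same histograms, then there is a matching that covers
almost all of `A` and is a local isomorphism almost everywhere. -/
theorem exists_matching {Δ : ℕ} (hΔ1 : 1 ≤ Δ) {x : ℝ} (hx : 0 < x) :
    ∃ κ : ℝ, 0 < κ ∧ κ ≤ 1 ∧ ∀ k : ℕ, ∃ t : ℕ, ∀ {σ : Schema} (X : Database σ) [Fintype X.Dom]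
      [DecidableEq X.Dom] (A a : Finset X.Dom) (K : X.Dom → Finset X.Dom),
      X.IsUnionOfComponents A → X.localSymmetry.IsPartition k A K → a ⊆ A →
      (∀ v ∈ A, v ∉ a → X.ball 1 v ⊆ K v) → (∀ v, (X.ball 1 v).ncard ≤ Δ) →
      X.IsBalanced A t (κ * Fintype.card X.Dom) → (a.card : ℝ) ≤ κ * Fintype.card X.Dom →
      ∃ U ψ, X.IsMatching A 0 U ψ ∧ ((A \ U).card : ℝ) ≤ x * Fintype.card X.Dom ∧
        ((X.bad U ψ).card : ℝ) ≤ x * Fintype.card X.Dom := by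
  set C : ℝ := 4 * Δ / x ^ 2 with hC
  have hC0 : 0 ≤ C := by positivity
  obtain ⟨κ, hκ, hκ1, hκx, hκe⟩ : ∃ κ : ℝ, 0 < κ ∧ κ ≤ 1 ∧ 2 * κ ≤ x ^ 2 / 2 ∧
      κ * Real.exp C ≤ x := by
    refine ⟨min 1 (min (x ^ 2 / 4) (x / Real.exp C)), by positivity, min_le_left _ _, ?_, ?_⟩
    · have := (min_le_right 1 _).trans (min_le_left (x ^ 2 / 4) (x / Real.exp C))
      linarith
    · rw [← le_div_iff₀ (Real.exp_pos _)]
      exact (min_le_right _ _).trans (min_le_right _ _)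
  refine ⟨κ, hκ, hκ1, fun k => ?_⟩
  set b : ℕ := Δ ^ k with hb
  have hb1 : (1 : ℝ) ≤ b := by exact_mod_cast Nat.one_le_pow _ _ hΔ1
  obtain ⟨J, hJ⟩ := exists_nat_ge (2 * (b : ℝ) ^ 2 / (κ / 2) ^ 2)
  rw [div_le_iff₀ (by positivity), mul_comm (J : ℝ)] at hJ
  have hJ0 : 0 < J := by
    rcases Nat.eq_zero_or_pos J with h0 | h0
    · rw [h0] at hJ
      simp only [Nat.cast_zero, mul_zero] at hJ
      have : 0 < 2 * (b : ℝ) ^ 2 := by positivity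
      linarith
    · exact h0
  have hΔ0 : (0 : ℝ) < Δ := by exact_mod_cast hΔ1
  set δ : ℝ := κ / 2 / (2 * b * Δ) with hδ
  have hδ0 : 0 < δ := by positivity
  have hδκ : 2 * b * (δ * Δ) ≤ κ / 2 := by
    rw [hδ]
    field_simp
    rfl
  obtain ⟨T, hT⟩ := exists_nat_gt (1 / δ)
  rw [div_lt_iff₀ hδ0] at hT
  refine ⟨1 + 2 * k * J * T, ?_⟩
  intro σ X _ _ A a K hA hK haA ha hΔ hbal hacard
  set N : ℝ := (Fintype.card X.Dom : ℝ) with hN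
  have hN0 : 0 ≤ N := Nat.cast_nonneg _
  have hball : ∀ v, (X.localSymmetry.ball k v).card ≤ b := fun v => by
    change (Set.toFinite (X.ball k v)).toFinset.card ≤ b
    rw [← Set.ncard_eq_toFinset_card]
    exact ncard_ball_le hΔ k v
  have key : ∀ i j, i + j = T → ∃ U ψ, X.IsMatching A (1 + 2 * k * J * j) U ψ ∧
      X.HasFewBad κ C U ψ ∧ (((A \ U).card : ℝ) ≤ x * N ∨ i * (δ * N) ≤ U.card) := by
    intro i
    induction i with
    | zero =>
      intro j hj
      refine ⟨∅, id, ⟨by simp, by simp, by simp, by simp⟩, ?_, by simp⟩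
      simp [HasFewBad, bad]
    | succ i ih =>
      intro j hj
      obtain ⟨U, ψ, hm, hfew, hor⟩ := ih (j + 1) (by omega)
      rcases hor with h1 | h1
      · exact ⟨U, ψ, hm.anti (by gcongr; omega), hfew, Or.inl h1⟩
      · obtain ⟨U', ψ', hm', hfew', hor'⟩ := IsMatching.exists_phase (s := 1 + 2 * k * J * j)
          (k := k) (J := J) (t := 1 + 2 * k * J * T) (by convert hm using 1; ring) hA hK haA ha
          (by omega) hΔ hΔ1 hball hx hκ hκx hJ0 hJ hδκ
          (by
            rw [← hj]
            nlinarith [Nat.zero_le (k * J * i)]) hbal hacard hfew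
        refine ⟨U', ψ', hm', hfew', hor'.imp_right fun h2 => ?_⟩
        push_cast
        linarith
  obtain ⟨U, ψ, hm, hfew, hor⟩ := key T 0 (by omega)
  have hUN : (U.card : ℝ) ≤ N := Nat.cast_le.2 (Finset.card_le_univ U)
  refine ⟨U, ψ, hm.anti (by omega), ?_, ?_⟩
  · rcases hor with h1 | h1
    · exact h1
    · rcases hN0.eq_or_lt with h0 | h0
      · have : ((A \ U).card : ℝ) ≤ N := Nat.cast_le.2 (Finset.card_le_univ _)
        rw [← h0] at this ⊢
        simpa using this
      · nlinarith
  · rcases hN0.eq_or_lt with h0 | h0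
    · have : ((X.bad U ψ).card : ℝ) ≤ N := Nat.cast_le.2 (Finset.card_le_univ _)
      rw [← h0] at this ⊢
      simpa using this
    · rw [← div_le_iff₀ h0]
      have h1 : κ + (X.bad U ψ).card / N ≤ κ * Real.exp (C * (U.card / N)) := hfew
      have h2 : κ * Real.exp (C * (U.card / N)) ≤ κ * Real.exp C := by
        gcongr
        exact mul_le_of_le_one_right hC0 (div_le_one_of_le₀ hUN hN0)
      linarith

end Database

namespace Database

variable {σ : Schema}

theorem Isomorphic.symm {D E : Database σ} (h : Isomorphic D E) : Isomorphic E D := by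
  obtain ⟨e, he⟩ := h
  refine ⟨e.symm, fun R t => ?_⟩
  rw [he R]
  simp

theorem Isomorphic.trans {D E F : Database σ} (h : Isomorphic D E) (h' : Isomorphic E F) :
    Isomorphic D F := by
  obtain ⟨e, he⟩ := h
  obtain ⟨f, hf⟩ := h'
  exact ⟨e.trans f, fun R t => (he R t).trans (hf R _)⟩

theorem ModifiesIn.trans {k l : ℕ} {D E F : Database σ} (h : ModifiesIn k D E)
    (h' : ModifiesIn l E F) : ModifiesIn (k + l) D F := by
  induction h with
  | refl D => rwa [zero_add]
  | step h hs ih =>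
    rw [Nat.add_right_comm]
    exact .step h (ih h')

theorem removeTuples_removeTuples (D : Database σ) (S T : Set D.Fact) :
    (D.removeTuples S).removeTuples (show Set (D.removeTuples S).Fact from T) =
      D.removeTuples (S ∪ T) := by
  unfold removeTuples withFacts
  congr 1
  funext R
  ext t
  change ((_ ∧ _) ∧ _) ↔ (_ ∧ _)
  rw [Set.mem_union, not_or, and_assoc]

theorem removeTuples_empty (D : Database σ) : D.removeTuples ∅ = D := by
  unfold removeTuples withFacts
  simp only [Set.sdiff_empty]
  rfl

theorem modifiesIn_removeTuples (D : Database σ) (S : Set D.Fact) (hS : S ⊆ D.facts) :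
    ModifiesIn S.ncard D (D.removeTuples S) := by
  induction hn : S.ncard generalizing D S with
  | zero =>
    rw [Set.ncard_eq_zero (Set.toFinite S)] at hn
    subst hn
    rw [removeTuples_empty]
    exact .refl D
  | succ n ih =>
    obtain ⟨f, hf⟩ : S.Nonempty := by
      rw [Set.nonempty_iff_ne_empty]
      rintro rfl
      simp at hn
    have hn' : (S \ {f}).ncard = n := by
      rw [Set.ncard_sdiff_singleton_of_mem hf]
      omega
    have := ih (D.removeTuples {f}) (S \ {f}) (fun g hg => ⟨hS hg.1, hg.2⟩) hn'
    have h2 := removeTuples_removeTuples D {f} (S \ {f})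
    rw [Set.union_sdiff_cancel (by simpa using hf)] at h2
    rw [← h2]
    exact .step (.deleteTuple D f (hS hf)) this

theorem exists_modifiesIn_induce (D : Database σ) (U : Set D.Dom) :
    ∃ E, ModifiesIn Uᶜ.ncard D E ∧ Isomorphic E (D.induce U) := by
  induction hn : Uᶜ.ncard generalizing D with
  | zero =>
    rw [Set.ncard_eq_zero (Set.toFinite _), Set.compl_empty_iff] at hn
    subst hn
    exact ⟨D, .refl D, (Equiv.Set.univ D.Dom).symm, fun R t => Iff.rfl⟩
  | succ n ih =>
    obtain ⟨a, ha⟩ : Uᶜ.Nonempty := by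
      rw [Set.nonempty_iff_ne_empty]
      intro h
      rw [h] at hn
      simp at hn
    set U₁ : Set (D.deleteElement a).Dom := {x | x.1 ∈ U} with hU₁
    have hn' : U₁ᶜ.ncard = n := by
      have h1 : Subtype.val '' U₁ᶜ = Uᶜ \ {a} := by
        ext x
        constructor
        · rintro ⟨y, hy, rfl⟩
          exact ⟨hy, y.2⟩
        · rintro ⟨hx, hxa⟩
          exact ⟨⟨x, hxa⟩, hx, rfl⟩
      refine (Set.ncard_image_of_injective U₁ᶜ Subtype.val_injective).symm.trans
        ((congrArg Set.ncard h1).trans ?_)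
      rw [Set.ncard_sdiff_singleton_of_mem ha]
      omega
    obtain ⟨E, hE, hiso⟩ := ih (D.deleteElement a) U₁ hn'
    refine ⟨E, .step (.deleteElement D a) hE, hiso.trans ⟨?_, ?_⟩⟩
    · exact
        { toFun := fun x => ⟨x.1.1, x.2⟩
          invFun := fun x => ⟨⟨x.1, fun h => ha ((Set.mem_singleton_iff.1 h) ▸ x.2)⟩, x.2⟩
          left_inv := fun _ => rfl
          right_inv := fun _ => rfl }
    · exact fun R t => Iff.rfl

theorem modDist_le {D E : Database σ} {S : Set D.Fact} (hS : S ⊆ D.facts) {S' : Set E.Fact}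
    (hS' : S' ⊆ E.facts) {U : Set D.Dom} {U' : Set E.Dom}
    (h : Isomorphic ((D.removeTuples S).induce U) ((E.removeTuples S').induce U')) :
    modDist D E ≤ (S.ncard + Uᶜ.ncard) + (S'.ncard + U'ᶜ.ncard) := by
  obtain ⟨D₁, hD, hD'⟩ := exists_modifiesIn_induce (D.removeTuples S) U
  obtain ⟨E₁, hE, hE'⟩ := exists_modifiesIn_induce (E.removeTuples S') U'
  exact Nat.sInf_le ⟨_, _, D₁, E₁, rfl, (modifiesIn_removeTuples D S hS).trans hD,
    (modifiesIn_removeTuples E S' hS').trans hE, hD'.trans (h.trans hE'.symm)⟩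

theorem ncard_facts_meeting_le {D : Database σ} {d : ℕ} (hD : D.DegreeLE d) (Z : Set D.Dom) :
    {f ∈ D.facts | ∃ i, f.2 i ∈ Z}.ncard ≤ Z.ncard * d := by
  classical
  have hZ : Z.Finite := Set.toFinite Z
  have hsub : {f ∈ D.facts | ∃ i, f.2 i ∈ Z} ⊆ (hZ.toFinset.biUnion fun z =>
      (Set.toFinite {f ∈ D.facts | z ∈ Set.range f.2}).toFinset) := by
    rintro f ⟨hf, i, hi⟩
    simp only [Finset.coe_biUnion, Set.mem_iUnion]
    exact ⟨f.2 i, by simpa using hi, by simpa using hf⟩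
  have h := Set.ncard_le_ncard hsub (Finset.finite_toSet _)
  rw [Set.ncard_coe_finset] at h
  refine h.trans ?_
  rw [Set.ncard_eq_toFinset_card Z hZ]
  refine Finset.card_biUnion_le_card_mul _ _ d fun z _ => ?_
  rw [← Set.ncard_eq_toFinset_card]
  exact hD z

/-- `X` is the disjoint union of `D`, with domain embedded as `A`, and `E`. -/
structure IsDisjointUnion (D E X : Database σ) (A : Finset X.Dom) (ι : D.Dom → X.Dom)
    (ι' : E.Dom → X.Dom) : Prop where
  left : IsComponentEmbedding D X ι
  right : IsComponentEmbedding E X ι'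
  mem_iff : ∀ v, v ∈ A ↔ v ∈ Set.range ι
  notMem_iff : ∀ v, v ∉ A ↔ v ∈ Set.range ι'

/-- A matching in the disjoint union of two databases bounds their distance. -/
theorem IsDisjointUnion.modDist_le {D E X : Database σ} [DecidableEq X.Dom] {A U : Finset X.Dom}
    {ι : D.Dom → X.Dom} {ι' : E.Dom → X.Dom} (hX : IsDisjointUnion D E X A ι ι')
    {ψ : X.Dom → X.Dom} {s d : ℕ} (h : X.IsMatching A s U ψ)
    (hD : D.DegreeLE d) (hE : E.DegreeLE d) :
    modDist E D + 2 * U.card ≤ D.size + E.size + 2 * ((X.bad U ψ).card * d) := by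
  have hinl := hX.left
  have hinr := hX.right
  have hA := hX.mem_iff
  set UD : Set D.Dom := {a | ι a ∈ U} with hUD
  set UE : Set E.Dom := {b | ι' b ∈ U.image ψ} with hUE
  have hg : ∀ a : UD, ∃ b : UE, ψ (ι a.1) = ι' b.1 := by
    rintro ⟨a, ha⟩
    obtain ⟨b, hb⟩ := (hX.notMem_iff _).1 (h.notMem _ ha)
    refine ⟨⟨b, ?_⟩, hb.symm⟩
    change ι' b ∈ U.image ψ
    rw [hb]
    exact Finset.mem_image_of_mem _ ha
  choose g hg using hg
  have hginj : Function.Injective g := by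
    intro a b hab
    have : ψ (ι a.1) = ψ (ι b.1) := by rw [hg, hg, hab]
    exact Subtype.ext (hinl.injective (h.injOn a.2 b.2 this))
  have hgsurj : Function.Surjective g := by
    rintro ⟨b, hb⟩
    obtain ⟨u, hu, hub⟩ := Finset.mem_image.1 hb
    obtain ⟨a, rfl⟩ := (hA u).1 (h.subset hu)
    refine ⟨⟨a, hu⟩, Subtype.ext (hinr.injective ?_)⟩
    rw [← hg, hub]
  have hcardD : UD.ncard = U.card := by
    have : (ι '' UD : Set X.Dom) = U := by
      ext v
      constructor
      · rintro ⟨a, ha, rfl⟩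
        exact ha
      · intro hv
        obtain ⟨a, rfl⟩ := (hA v).1 (h.subset hv)
        exact ⟨a, hv, rfl⟩
    rw [← Set.ncard_image_of_injective UD hinl.injective]
    exact (congrArg Set.ncard this).trans (Set.ncard_coe_finset U)
  have hcardE : UE.ncard = U.card := by
    rw [← hcardD]
    exact (Nat.card_congr (Equiv.ofBijective g ⟨hginj, hgsurj⟩)).symm
  set Z := X.bad U ψ with hZ
  have hZU : Z ⊆ U := fun v hv => (mem_bad.1 hv).1
  set ZD : Set D.Dom := {a | ι a ∈ Z} with hZD
  set ZE : Set E.Dom := {b | ι' b ∈ Z.image ψ} with hZE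
  have hZDcard : ZD.ncard ≤ Z.card := by
    rw [← Set.ncard_image_of_injective ZD hinl.injective,
      ← Set.ncard_coe_finset Z]
    refine Set.ncard_le_ncard ?_ (Finset.finite_toSet _)
    rintro _ ⟨a, ha, rfl⟩
    exact ha
  have hZEcard : ZE.ncard ≤ Z.card := by
    refine le_trans ?_ (Finset.card_image_le (s := Z) (f := ψ))
    rw [← Set.ncard_image_of_injective ZE hinr.injective,
      ← Set.ncard_coe_finset (Z.image ψ)]
    refine Set.ncard_le_ncard ?_ (Finset.finite_toSet _)
    rintro _ ⟨a, ha, rfl⟩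
    exact ha
  have hZiff : ∀ a : UD, a.1 ∈ ZD ↔ (g a).1 ∈ ZE := by
    intro a
    constructor
    · intro ha
      change ι' (g a).1 ∈ Z.image ψ
      rw [← hg]
      exact Finset.mem_image_of_mem ψ ha
    · intro ha
      obtain ⟨z, hz, hza⟩ := Finset.mem_image.1 (show ι' (g a).1 ∈ Z.image ψ from ha)
      rw [← hg] at hza
      have := h.injOn (hZU hz) a.2 hza
      change ι a.1 ∈ Z
      rwa [← this]
  have hrel : ∀ R (t : Fin (σ.arity R) → UD), (∃ i, (t i).1 ∉ ZD) →
      ((fun i => (t i).1) ∈ D.rel R ↔ (fun i => (g (t i)).1) ∈ E.rel R) := by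
    rintro R t ⟨i, hi⟩
    have hgood : X.IsGood U ψ (ι (t i).1) := by
      by_contra hn
      exact hi (mem_bad.2 ⟨(t i).2, hn⟩)
    have hcomp : (ψ ∘ (ι ∘ fun j => (t j).1) : Fin (σ.arity R) → X.Dom)
        = ι' ∘ fun j => (g (t j)).1 := funext fun j => hg (t j)
    rw [hinl.rel_iff R, hinr.rel_iff R, ← hcomp]
    constructor
    · exact fun ht => (hgood.rel_map R _ ht i rfl).2
    · intro ht
      obtain ⟨x, hx, hxU, hxt⟩ := hgood.rel_of_map R _ ht i rfl
      have : x = ι ∘ fun j => (t j).1 :=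
        funext fun j => h.injOn (hxU j) (t j).2 (congrFun hxt j).symm
      rwa [← this]
  have key := Database.modDist_le (D := E) (E := D) (S := {f ∈ E.facts | ∃ i, f.2 i ∈ ZE})
    (S' := {f ∈ D.facts | ∃ i, f.2 i ∈ ZD}) (fun _ hf => hf.1) (fun _ hf => hf.1) (U := UE)
    (U' := UD) (by
      refine Isomorphic.symm ⟨Equiv.ofBijective g ⟨hginj, hgsurj⟩,
        fun R (t : Fin (σ.arity R) → UD) => ?_⟩
      change (((fun i => (t i).1) ∈ D.rel R) ∧ ¬ (((fun i => (t i).1) ∈ D.rel R) ∧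
        ∃ i, (t i).1 ∈ ZD)) ↔ (((fun i => (g (t i)).1) ∈ E.rel R) ∧
          ¬ (((fun i => (g (t i)).1) ∈ E.rel R) ∧ ∃ i, (g (t i)).1 ∈ ZE))
      simp only [← hZiff]
      by_cases hi : ∃ i, (t i).1 ∈ ZD
      · tauto
      · have := hrel R t ⟨⟨0, σ.arity_pos R⟩, fun h => hi ⟨_, h⟩⟩
        tauto)
  have h1 := ncard_facts_meeting_le hE ZE
  have h2 := ncard_facts_meeting_le hD ZD
  have h3 : UD.ncard + UDᶜ.ncard = D.size := Set.ncard_add_ncard_compl UD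
  have h4 : UE.ncard + UEᶜ.ncard = E.size := Set.ncard_add_ncard_compl UE
  have h5 := Nat.mul_le_mul_right d hZDcard
  have h6 := Nat.mul_le_mul_right d hZEcard
  omega

end Database

namespace Database

variable {σ : Schema}

theorem sum_typeOf (D : Database σ) [Fintype D.Dom] (r : ℕ) (F : NeighbourhoodType σ → ℝ)
    {T : Finset (NeighbourhoodType σ)} (hT : ∀ a, D.typeOf r a ∈ T) :
    ∑ a, F (D.typeOf r a) = ∑ τ ∈ T, F τ * D.histogram r τ := by
  classical
  rw [← Finset.sum_fiberwise_of_maps_to (s := Finset.univ) (t := T) (g := D.typeOf r)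
    fun a _ => hT a]
  refine Finset.sum_congr rfl fun τ _ => ?_
  have h1 : ∀ a ∈ Finset.univ.filter (fun a => D.typeOf r a = τ), F (D.typeOf r a) = F τ :=
    fun a ha => by rw [(Finset.mem_filter.1 ha).2]
  rw [Finset.sum_congr rfl h1, Finset.sum_const, nsmul_eq_mul, mul_comm, histogram,
    ← Set.ncard_coe_finset]
  simp

theorem sum_sub_sum_le_histogramDist (D E : Database σ) [Fintype D.Dom] [Fintype E.Dom] (r : ℕ)
    (F : NeighbourhoodType σ → ℝ) (hF : ∀ τ, |F τ| ≤ 1) :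
    ∑ a, F (D.typeOf r a) - ∑ b, F (E.typeOf r b) ≤ histogramDist r D E := by
  have hfin := (Set.finite_range (D.typeOf r)).union (Set.finite_range (E.typeOf r))
  set T := hfin.toFinset with hT
  have hTD : ∀ a, D.typeOf r a ∈ T := fun a => by simp [hT]
  have hTE : ∀ a, E.typeOf r a ∈ T := fun a => by simp [hT]
  rw [sum_typeOf D r F hTD, sum_typeOf E r F hTE, ← Finset.sum_sub_distrib, histogramDist,
    finsum_eq_sum_of_support_subset (s := T)]
  · refine Finset.sum_le_sum fun τ _ => ?_
    rw [← mul_sub]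
    refine (le_abs_self _).trans ?_
    rw [abs_mul]
    exact mul_le_of_le_one_left (abs_nonneg _) (hF τ)
  · intro τ hτ
    by_contra hn
    rw [hT, Set.Finite.coe_toFinset, Set.mem_union, not_or, Set.mem_range, Set.mem_range,
      not_exists, not_exists] at hn
    refine hτ ?_
    simp [histogram, hn.1, hn.2]

theorem abs_size_sub_size_le (D E : Database σ) (r : ℕ) :
    |(D.size : ℝ) - E.size| ≤ histogramDist r D E := by
  have := Fintype.ofFinite D.Dom
  have := Fintype.ofFinite E.Dom
  have h1 := sum_sub_sum_le_histogramDist D E r (fun _ => 1) (by simp)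
  have h2 := sum_sub_sum_le_histogramDist D E r (fun _ => -1) (by simp)
  simp only [Finset.sum_const, Finset.card_univ, nsmul_eq_mul, ← Nat.card_eq_fintype_card] at h1 h2
  rw [size, size, abs_le]
  constructor <;> linarith

namespace IsDisjointUnion

variable {D E X : Database σ} {A : Finset X.Dom} {ι : D.Dom → X.Dom} {ι' : E.Dom → X.Dom}

theorem sum_eq [Fintype D.Dom] (h : IsDisjointUnion D E X A ι ι') (f : X.Dom → ℝ) :
    ∑ v ∈ A, f v = ∑ a, f (ι a) := by
  symm
  refine Finset.sum_nbij ι ?_ ?_ ?_ ?_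
  · exact fun a _ => (h.mem_iff _).2 ⟨a, rfl⟩
  · exact h.left.injective.injOn
  · intro v hv
    obtain ⟨a, rfl⟩ := (h.mem_iff v).1 hv
    exact ⟨a, by simp, rfl⟩
  · exact fun _ _ => rfl

theorem card_eq (h : IsDisjointUnion D E X A ι ι') : A.card = D.size := by
  have := Fintype.ofFinite D.Dom
  have := h.sum_eq fun _ => 1
  simp only [Finset.sum_const, nsmul_eq_mul, mul_one, Finset.card_univ] at this
  rw [size, Nat.card_eq_fintype_card]
  exact_mod_cast this

theorem isUnionOfComponents (h : IsDisjointUnion D E X A ι ι') : X.IsUnionOfComponents A := by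
  intro R t ht i j hi
  obtain ⟨a, ha⟩ := (h.mem_iff _).1 hi
  obtain ⟨s, rfl⟩ := h.left.exists_of_mem R t ht i a ha.symm
  exact (h.mem_iff _).2 ⟨s j, rfl⟩

theorem ncard_ball_one_le (h : IsDisjointUnion D E X A ι ι') {d m : ℕ} (hD : D.DegreeLE d)
    (hE : E.DegreeLE d) (hm : ∀ R, σ.arity R ≤ m) (v : X.Dom) :
    (X.ball 1 v).ncard ≤ d * m + 1 := by
  by_cases hv : v ∈ A
  · obtain ⟨a, rfl⟩ := (h.mem_iff _).1 hv
    rw [h.left.ncard_ball]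
    exact Database.ncard_ball_one_le hD hm a
  · obtain ⟨b, rfl⟩ := (h.notMem_iff _).1 hv
    rw [h.right.ncard_ball]
    exact Database.ncard_ball_one_le hE hm b

variable [Fintype X.Dom] [DecidableEq X.Dom]

theorem sum_compl_eq [Fintype E.Dom] (h : IsDisjointUnion D E X A ι ι') (f : X.Dom → ℝ) :
    ∑ v ∈ Aᶜ, f v = ∑ b, f (ι' b) := by
  symm
  refine Finset.sum_nbij ι' ?_ ?_ ?_ ?_
  · exact fun a _ => Finset.mem_compl.2 ((h.notMem_iff _).2 ⟨a, rfl⟩)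
  · exact h.right.injective.injOn
  · intro v hv
    obtain ⟨a, rfl⟩ := (h.notMem_iff v).1 (Finset.mem_compl.1 hv)
    exact ⟨a, by simp, rfl⟩
  · exact fun _ _ => rfl

theorem card_compl_eq (h : IsDisjointUnion D E X A ι ι') : Aᶜ.card = E.size := by
  have := Fintype.ofFinite E.Dom
  have := h.sum_compl_eq fun _ => 1
  simp only [Finset.sum_const, nsmul_eq_mul, mul_one, Finset.card_univ] at this
  rw [size, Nat.card_eq_fintype_card]
  exact_mod_cast this

theorem isBalanced (h : IsDisjointUnion D E X A ι ι') {r : ℕ} {β : ℝ}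
    (hβ : histogramDist r D E ≤ β) : X.IsBalanced A r β := by
  classical
  intro c hc hc1
  have := Fintype.ofFinite D.Dom
  have := Fintype.ofFinite E.Dom
  set F : NeighbourhoodType σ → ℝ := fun τ =>
    if hτ : ∃ v, X.typeOf r v = τ then c hτ.choose else 0 with hF
  have hcF : ∀ v, c v = F (X.typeOf r v) := by
    intro v
    have hτ : ∃ w, X.typeOf r w = X.typeOf r v := ⟨v, rfl⟩
    simp only [hF]
    rw [dif_pos hτ]
    obtain ⟨e, he, hev⟩ := exists_isLocalSymmetry hτ.choose_spec
    rw [← hc _ e (mem_localSymmetry_sym.2 he), hev]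
  have hF1 : ∀ τ, |F τ| ≤ 1 := by
    intro τ
    simp only [hF]
    split
    · exact hc1 _
    · simp
  have key := sum_sub_sum_le_histogramDist D E r F hF1
  rw [h.sum_eq, h.sum_compl_eq]
  simp only [hcF, h.left.typeOf_eq, h.right.typeOf_eq]
  linarith

end IsDisjointUnion

/-- The set of elements in the connected component of `a`. -/
def componentOf (E : Database σ) (a : E.Dom) : Set E.Dom := {b | E.gaifman.Reachable a b}

theorem mem_ball_of_reachable {E : Database σ} {k : ℕ}
    (hk : ∀ c : E.gaifman.ConnectedComponent, c.supp.ncard ≤ k) {a b : E.Dom}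
    (h : b ∈ E.componentOf a) : b ∈ E.ball k a := by
  classical
  obtain ⟨w⟩ := h
  refine ball_mono ?_ a (mem_ball_of_walk w.toPath.1)
  have hnd := w.toPath.2.support_nodup
  have hsub : (w.toPath.1.support.toFinset : Set E.Dom) ⊆
      (E.gaifman.connectedComponentMk a).supp := by
    intro c hc
    rw [List.coe_toFinset] at hc
    exact SimpleGraph.ConnectedComponent.sound (w.toPath.1.takeUntil c hc).reachable.symm
  have h1 := (Set.ncard_le_ncard hsub).trans (hk _)
  rw [Set.ncard_coe_finset, List.toFinset_card_of_nodup hnd,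
    SimpleGraph.Walk.length_support] at h1
  omega

theorem ball_removeTuples_subset (D : Database σ) (S : Set D.Fact) (r : ℕ) (a : D.Dom) :
    (D.removeTuples S).ball r a ⊆ D.ball r a := by
  induction r with
  | zero => exact (ball_zero (D.removeTuples S) a).trans_subset (ball_zero D a).symm.subset
  | succ r ih =>
    intro b hb
    obtain ⟨c, hc, h⟩ := mem_ball_succ.1 hb
    refine mem_ball_succ.2 ⟨c, ih hc, h.imp_right ?_⟩
    rintro ⟨R, t, ht, h⟩
    exact ⟨R, t, ht.1, h⟩

/-- Elements adjacent to other components after removing `S` lie in tuples of `S`. -/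
theorem exists_mem_of_not_subset {D : Database σ} {S : Set D.Fact} {a : D.Dom}
    (h : ¬ D.ball 1 a ⊆ (D.removeTuples S).componentOf a) : ∃ f ∈ S, ∃ i, f.2 i = a := by
  obtain ⟨b, hb, hn⟩ := Set.not_subset.1 h
  rcases mem_ball_one.1 hb with rfl | ⟨R, t, ht, i, j, rfl, rfl⟩
  · exact absurd (SimpleGraph.Reachable.refl _) hn
  · refine ⟨⟨R, t⟩, ?_, i, rfl⟩
    by_contra hS
    refine hn ?_
    by_cases hij : t i = t j
    · rw [← hij]
      exact SimpleGraph.Reachable.refl _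
    · have : (D.removeTuples S).gaifman.Adj (t i) (t j) :=
        gaifman_adj.2 ⟨hij, R, t, ⟨ht, hS⟩, ⟨i, rfl⟩, ⟨j, rfl⟩⟩
      exact this.reachable

theorem ncard_not_subset_le {D : Database σ} {S : Set D.Fact} {m : ℕ}
    (hm : ∀ R, σ.arity R ≤ m) :
    {a | ¬ D.ball 1 a ⊆ (D.removeTuples S).componentOf a}.ncard ≤ S.ncard * m := by
  classical
  have hS : S.Finite := Set.toFinite S
  have hsub : {a | ¬ D.ball 1 a ⊆ (D.removeTuples S).componentOf a} ⊆
      (hS.toFinset.biUnion fun f : D.Fact => Finset.univ.image f.2) := by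
    intro a ha
    obtain ⟨f, hf, i, rfl⟩ := exists_mem_of_not_subset ha
    simp only [Finset.coe_biUnion, Set.mem_iUnion]
    exact ⟨f, by simpa using hf, by simp⟩
  have h := Set.ncard_le_ncard hsub (Finset.finite_toSet _)
  rw [Set.ncard_coe_finset] at h
  refine h.trans ?_
  rw [Set.ncard_eq_toFinset_card S hS]
  exact Finset.card_biUnion_le_card_mul _ _ m fun f _ =>
    Finset.card_image_le.trans (by simpa using hm f.1)

/-- A partition of `D` gives a partition of the copy of `D` in a disjoint union. -/
theorem IsDisjointUnion.exists_isPartition {D E X : Database σ} {A : Finset X.Dom}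
    {ι : D.Dom → X.Dom} {ι' : E.Dom → X.Dom} (h : IsDisjointUnion D E X A ι ι') {S : Set D.Fact}
    {k m : ℕ} (hm : ∀ R, σ.arity R ≤ m)
    (hk : ∀ c : (D.removeTuples S).gaifman.ConnectedComponent, c.supp.ncard ≤ k) :
    ∃ (K : X.Dom → Finset X.Dom) (a : Finset X.Dom), X.localSymmetry.IsPartition k A K ∧ a ⊆ A ∧
      (∀ v ∈ A, v ∉ a → X.ball 1 v ⊆ K v) ∧ a.card ≤ S.ncard * m := by
  classical
  set K : X.Dom → Finset X.Dom := fun v =>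
    (Set.toFinite {w | ∃ x y, ι x = v ∧ ι y = w ∧ y ∈ (D.removeTuples S).componentOf x}).toFinset
    with hKdef
  have hK : ∀ x w, w ∈ K (ι x) ↔ ∃ y, ι y = w ∧ y ∈ (D.removeTuples S).componentOf x := by
    intro x w
    simp only [hKdef, Set.Finite.mem_toFinset, Set.mem_ofPred_eq]
    constructor
    · rintro ⟨x', y, hx, hy, hxy⟩
      rw [h.left.injective hx] at hxy
      exact ⟨y, hy, hxy⟩
    · rintro ⟨y, hy, hxy⟩
      exact ⟨x, y, rfl, hy, hxy⟩
  set a₀ : Set D.Dom := {x | ¬ D.ball 1 x ⊆ (D.removeTuples S).componentOf x} with ha₀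
  refine ⟨K, (Set.toFinite (ι '' a₀)).toFinset, ⟨?_, ?_, ?_, ?_⟩, ?_, ?_, ?_⟩
  · intro v hv
    obtain ⟨x, rfl⟩ := (h.mem_iff _).1 hv
    exact (hK x _).2 ⟨x, rfl, SimpleGraph.Reachable.refl _⟩
  · intro v hv w hw
    obtain ⟨x, rfl⟩ := (h.mem_iff _).1 hv
    obtain ⟨y, rfl, -⟩ := (hK x _).1 hw
    exact (h.mem_iff _).2 ⟨y, rfl⟩
  · intro v hv w hw
    obtain ⟨x, rfl⟩ := (h.mem_iff _).1 hv
    obtain ⟨y, rfl, hy⟩ := (hK x _).1 hw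
    rw [mem_localSymmetry_ball, h.left.ball_eq]
    exact ⟨y, ball_removeTuples_subset D S k x (mem_ball_of_reachable hk hy), rfl⟩
  · intro v hv w hw
    obtain ⟨x, rfl⟩ := (h.mem_iff _).1 hv
    obtain ⟨y, rfl, hy⟩ := (hK x _).1 hw
    ext z
    rw [hK, hK]
    constructor
    · rintro ⟨z, rfl, hz⟩
      exact ⟨z, rfl, SimpleGraph.Reachable.trans hy hz⟩
    · rintro ⟨z, rfl, hz⟩
      exact ⟨z, rfl, SimpleGraph.Reachable.trans (SimpleGraph.Reachable.symm hy) hz⟩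
  · intro v hv
    obtain ⟨x, -, rfl⟩ := (Set.Finite.mem_toFinset _).1 hv
    exact (h.mem_iff _).2 ⟨x, rfl⟩
  · intro v hv hva w hw
    obtain ⟨x, rfl⟩ := (h.mem_iff _).1 hv
    rw [h.left.ball_eq] at hw
    obtain ⟨y, hy, rfl⟩ := hw
    refine (hK x _).2 ⟨y, rfl, ?_⟩
    by_contra hn
    exact hva ((Set.Finite.mem_toFinset _).2 ⟨x, fun hsub => hn (hsub hy), rfl⟩)
  · rw [← Set.ncard_eq_toFinset_card, Set.ncard_image_of_injective _ h.left.injective]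
    exact ncard_not_subset_le hm

theorem exists_isDisjointUnion (D E : Database σ) :
    ∃ A : Finset (D.sum E).Dom, IsDisjointUnion D E (D.sum E) A Sum.inl Sum.inr := by
  refine ⟨(Set.toFinite (Set.range (Sum.inl : D.Dom → (D.sum E).Dom))).toFinset,
    isComponentEmbedding_inl D E, isComponentEmbedding_inr D E,
    fun v => Set.Finite.mem_toFinset _, fun v => ?_⟩
  refine (not_congr (Set.Finite.mem_toFinset _)).trans ?_
  rcases v with a | b
  · exact ⟨fun h => absurd ⟨a, rfl⟩ h, fun ⟨b, hb⟩ => absurd hb Sum.inr_ne_inl⟩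
  · exact ⟨fun _ => ⟨b, rfl⟩, fun _ ⟨a, ha⟩ => Sum.inl_ne_inr ha⟩

end Database

theorem mainTheorem5 (σ : Schema) (d : ℕ) (hd : 2 ≤ d)
    (C P : Set (Database σ))
    (hCiso : Database.IsoClosed C)
    (hCdeg : ∀ D ∈ C, D.DegreeLE d)
    (hCrem : Database.ClosedUnderTupleRemoval C)
    (hPiso : Database.IsoClosed P)
    (hPC : P ⊆ C)
    (hPhyp : Database.HyperfiniteOn P C)
    (ε : ℝ) (hε : 0 < ε) (hε1 : ε ≤ 1) :
    ∃ (lam : ℝ) (r : ℕ), 0 < lam ∧ lam ≤ 1 ∧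
      ∀ D ∈ P, ∀ D' ∈ C,
        Database.histogramDist r D D' ≤ lam * (min D.size D'.size : ℕ) →
          Database.IsCloseTo d ε D' P := by
  classical
  obtain ⟨m, hm⟩ : ∃ m, ∀ R, σ.arity R ≤ m := by
    obtain ⟨m, hm⟩ := (Set.finite_range σ.arity).bddAbove
    exact ⟨m, fun R => hm ⟨R, rfl⟩⟩
  obtain ⟨ρ, hρ⟩ := hPhyp
  have hd0 : (2 : ℝ) ≤ d := by exact_mod_cast hd
  set x : ℝ := ε / (30 * d) with hx
  have hx0 : 0 < x := by positivity
  have hxε : 30 * (x * d) = ε := by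
    rw [hx]
    field_simp
  obtain ⟨κ, hκ, hκ1, hmain⟩ := Database.exists_matching (Δ := d * m + 1) (by omega) hx0
  set η : ℝ := κ / (m + 1) with hη
  have hη0 : 0 < η := by positivity
  have hη1 : η ≤ 1 := div_le_one_of_le₀ (by linarith [Nat.cast_nonneg (α := ℝ) m]) (by positivity)
  obtain ⟨r, hr⟩ := hmain (ρ η)
  refine ⟨min κ x, r, by positivity, (min_le_left _ _).trans hκ1, fun D hD D' hD' hdist =>
    ⟨D, hD, ?_⟩⟩
  obtain ⟨E, -, S, -, hScard, rfl, hS⟩ := hρ η hη0 hη1 D hD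
  obtain ⟨A, hA⟩ := Database.exists_isDisjointUnion D D'
  have := Fintype.ofFinite (D.sum D').Dom
  obtain ⟨K, a, hK, haA, ha, hacard⟩ := hA.exists_isPartition hm hS
  set N : ℝ := (Fintype.card (D.sum D').Dom : ℝ) with hN
  set μ : ℝ := ((min D.size D'.size : ℕ) : ℝ) with hμ
  have hμ0 : 0 ≤ μ := Nat.cast_nonneg _
  have hNsum : N = D.size + D'.size := by
    have h1 := Finset.card_add_card_compl A
    rw [hA.card_eq, hA.card_compl_eq] at h1
    rw [hN]
    exact_mod_cast h1.symm
  have hsize := (Database.abs_size_sub_size_le D D' r).trans hdist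
  have hlam1 : min κ x * μ ≤ κ * μ := by
    gcongr
    exact min_le_left _ _
  have hlam2 : min κ x * μ ≤ x * μ := by
    gcongr
    exact min_le_right _ _
  have hDN : (D.size : ℝ) ≤ N := by
    rw [hNsum]
    exact le_add_of_nonneg_right (Nat.cast_nonneg _)
  have hμN : μ ≤ N := le_trans (Nat.cast_le.2 (min_le_left _ _)) hDN
  have hN3 : N ≤ 3 * μ := by
    have h1 : κ * μ ≤ μ := mul_le_of_le_one_left hμ0 hκ1
    have h2 := abs_le.1 hsize
    rcases le_total D.size D'.size with h | h
    · have : μ = D.size := by rw [hμ, min_eq_left h]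
      linarith
    · have : μ = D'.size := by rw [hμ, min_eq_right h]
      linarith
  obtain ⟨U, ψ, hU, hrem, hbad⟩ := hr (D.sum D') A a K hA.isUnionOfComponents hK haA ha
    (hA.ncard_ball_one_le (hCdeg D (hPC hD)) (hCdeg D' hD') hm)
    (hA.isBalanced (hdist.trans (hlam1.trans (by gcongr))))
    (by
      have h1 : (a.card : ℝ) ≤ S.ncard * m := by exact_mod_cast hacard
      calc (a.card : ℝ) ≤ η * D.size * m := h1.trans (by gcongr)
        _ ≤ η * N * (m + 1) := by
          gcongr
          linarith
        _ = κ * N := by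
          rw [hη]
          field_simp)
  have hdistle := hA.modDist_le hU (hCdeg D (hPC hD)) (hCdeg D' hD')
  have hdistle' : (Database.modDist D' D : ℝ) + 2 * U.card ≤
      D.size + D'.size + 2 * (((D.sum D').bad U ψ).card * d) := by exact_mod_cast hdistle
  have hcardU : ((A \ U).card : ℝ) + U.card = D.size := by
    rw [← hA.card_eq]
    exact_mod_cast Finset.card_sdiff_add_card_eq_card hU.subset
  have hbadd : (((D.sum D').bad U ψ).card : ℝ) * d ≤ x * N * d := by gcongr
  have hxN : x * N ≤ x * (3 * μ) := by gcongr
  have hxNd : x * N * d ≤ x * (3 * μ) * d := by gcongr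
  have hxd : x * μ * 2 ≤ x * μ * d := by gcongr
  have habs := (abs_le.1 hsize).1
  change (Database.modDist D' D : ℝ) ≤ ε * d * ((min D'.size D.size : ℕ) : ℝ)
  rw [min_comm, ← hμ]
  have hfinal : ε * μ * 1 ≤ ε * μ * d := by
    gcongr
    linarith
  have hεμ : ε * μ = 30 * (x * μ * d) := by
    rw [← hxε]
    ring
  have hnn : 0 ≤ x * μ * d := by positivity
  have e1 : ε * d * μ = ε * μ * d := by ring
  have e2 : x * (3 * μ) * d = 3 * (x * μ * d) := by ring
  linarith
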